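/- **Notation.** Let $K$ be a number field with a fixed embedding into $\mathbb L$, in one of two cases: (a) $\mathbb L=\mathbb R$ and $q=1$; (b) $\mathbb L=\mathbb C$, the embedding is not real (its image is not contained in $\mathbb R$), and $q=2$. Let $G^n=\mathbb L^n$ with its standard inner product. Superscripts on subspaces denote dimensions. Equip $\bigwedge^m G^n$ with the inner product for which the vectors $e_{i_1}\wedge\dots\wedge e_{i_m}$ ($i_1<\dots<i_m$) built from the standard basis are orthonormal. For non-zero $X,Y\in G^n$ let $\omega(X,Y)=\|X\wedge Y\|/(\|X\|\,\|Y\|)$, and for a subspace $B\ne\{0\}$ let $\omega(X,B)=\inf_{Y\in B\setminus\{0\}}\omega(X,Y)$. For subspaces $A^d,B^e$ and $1\le i\le\min(d,e)$ put $$\omega_i(A^d,B^e)=\inf_{F^i\subset A^d}\ \sup_{X\in F^i\setminus\{0\}}\omega(X,B^e),$$ where $F^i$ runs through the $i$-dimensional subspaces of $A^d$. A subspace $B^e$ of $G^n$ is defined over $K$ if it is spanned by vectors with coordinates in $K$. Its height is $$H(B^e)=N(\mathfrak a)^{-1}\prod_{\sigma:K\hookrightarrow\mathbb C}\|\sigma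 X_1\wedge\dots\wedge\sigma X_e\|,$$ where $X_1,\dots,X_e$ is any basis of $B^e\cap K^n$ over $K$, $\mathfrak a$ is the fractional ideal generated by the $e\times e$ minors of the matrix with rows $X_1,\dots,X_e$, and $\sigma$ runs through all the embeddings of $K$ into $\mathbb C$. **Theorem (Schmidt's going-down Theorem).** Let $A^d,B^e$ be subspaces of $G^n$, with $B^e$ defined over $K$ and $H(B^e)\le H$, where $H\ge1$. Let $1\le h\le\min(d,e-1)$. *Part 1.* Let $c\ge1$, let $y_1\ge\dots\ge y_h\ge (qh)^{-1}$, put $y=y_1+\dots+y_h$, and assume $$H(B^e)\,\omega_i(A^d,B^e)^q\le c^qH^{-(qy_i-1)}\quad(i=1,\dots,h),\qquad y_i':=\frac{y_ie}{qy+e-1}\ge q^{-1}\quad(i=1,\dots,h).$$ Then there is a subspace $B^{e-1}\subset B^e$, defined over $K$, with $$H(B^{e-1})\le C_5H(B^e)H^{(qy-1)/e}\le C_5H^{(e+qy-1)/e}=:H',$$ $$H(B^{e-1})\,\omega_i(A^d,B^{e-1})^q\le C_6c^qH^{-(qy_i'-1)(qy+e-1)/e}\le C_7c^qH'^{-(qy_i'-1)}\quad(i=1,\dots,h),$$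 $$\omega_i(A^d,B^{e-1})\le C_8\,c\,H(B^{e-1})^{-y_i'}\quad(i=1,\dots,h).$$ *Part 2.* Assume instead that $\omega_i(A^d,B^e)=0$ for $i=1,\dots,h$, and put $y_0'=e/(qh)$. Then for every $H'\ge C_9H$ there is a subspace $B^{e-1}\subset B^e$, defined over $K$, with $H(B^{e-1})\le H'$ and $$H(B^{e-1})\,\omega_i(A^d,B^{e-1})^q\le C_{10}H^{qy_0'}H'^{-(qy_0'-1)},\qquad \omega_i(A^d,B^{e-1})\le C_{11}H^{y_0'}H(B^{e-1})^{-y_0'}\quad(i=1,\dots,h).$$ Here $C_5,\dots,C_8$ are positive constants depending only on the embedded field $K$, on $n$ and on $y_1,\dots,y_h$; $C_9,C_{10},C_{11}$ are positive constants depending only on $K$ and $n$. In particular none of them depends on $A^d,B^e,B^{e-1},H,c$. -/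

import Mathlib

open scoped NumberField BigOperators

noncomputable section

namespace GoingDown

/-! ### Wedge products in coordinates -/

/-- The coordinate of `X₁ ∧ ⋯ ∧ X_d` on `e_{I 1} ∧ ⋯ ∧ e_{I d}` (`I 1 < ⋯ < I d`): the `d × d` minor,
with columns `I`, of the matrix with rows `X₁, …, X_d`. -/
def plucker {R : Type*} [CommRing R] {d n : ℕ} (X : Fin d → Fin n → R) (I : Fin d ↪o Fin n) : R :=
  Matrix.det (Matrix.of fun a b => X a (I b))

/-- The norm `‖X₁ ∧ ⋯ ∧ X_d‖` for the inner product on the exterior power of `𝕜ⁿ` for which the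
products `e_{I 1} ∧ ⋯ ∧ e_{I d}` of the standard basis vectors form an orthonormal basis. -/
def wedgeNorm {𝕜 : Type*} [RCLike 𝕜] {d n : ℕ} (X : Fin d → Fin n → 𝕜) : ℝ :=
  √(∑ I : Fin d ↪o Fin n, ‖plucker X I‖ ^ 2)

/-! ### Closeness of subspaces -/

/-- The projective distance `‖x ∧ y‖ / (‖x‖ ‖y‖)` of two non-zero vectors. -/
def projDist {𝕜 : Type*} [RCLike 𝕜] {n : ℕ} (x y : EuclideanSpace 𝕜 (Fin n)) : ℝ :=
  wedgeNorm ![WithLp.ofLp x, WithLp.ofLp y] / (‖x‖ * ‖y‖)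

/-- The distance from a non-zero vector `x` to a non-zero subspace `B`: the infimum of the projective
distances from `x` to the non-zero vectors of `B`. -/
def distTo {𝕜 : Type*} [RCLike 𝕜] {n : ℕ} (x : EuclideanSpace 𝕜 (Fin n))
    (B : Submodule 𝕜 (EuclideanSpace 𝕜 (Fin n))) : ℝ :=
  ⨅ y : {y : EuclideanSpace 𝕜 (Fin n) // y ∈ B ∧ y ≠ 0}, projDist x y.1

/-- `ω_i(A, B)`, meant for `1 ≤ i ≤ min (dim A) (dim B)`: the infimum over the `i`-dimensional
subspaces `F` of `A` of the supremum over the non-zero `x ∈ F` of the distance from `x` to `B`. -/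
def omega {𝕜 : Type*} [RCLike 𝕜] {n : ℕ} (i : ℕ)
    (A B : Submodule 𝕜 (EuclideanSpace 𝕜 (Fin n))) : ℝ :=
  ⨅ F : {F : Submodule 𝕜 (EuclideanSpace 𝕜 (Fin n)) // F ≤ A ∧ Module.finrank 𝕜 F = i},
    ⨆ x : {x : EuclideanSpace 𝕜 (Fin n) // x ∈ F.1 ∧ x ≠ 0}, distTo x.1 B

/-! ### Heights -/

/-- The height expression `N(𝔞)⁻¹ ∏_σ ‖σX₁ ∧ ⋯ ∧ σX_d‖` of linearly independent vectors
`X₁, …, X_d` of `Kⁿ`: here `𝔞` is the fractional ideal generated by the `d × d` minors, and `σ` runs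
through all the embeddings of `K` in `ℂ`. -/
def familyHeight {K : Type*} [Field K] [NumberField K] {d n : ℕ} (X : Fin d → Fin n → K) : ℝ :=
  ((FractionalIdeal.absNorm (FractionalIdeal.spanFinset (𝓞 K) Finset.univ (plucker X)) : ℚ) : ℝ)⁻¹ *
    ∏ σ : K →+* ℂ, wedgeNorm (fun a j => σ (X a j))

/-- The height of a subspace of `Kⁿ`, computed from a basis (any basis gives the same value, see
`subspaceHeight_eq`). -/
def subspaceHeight {K : Type*} [Field K] [NumberField K] {n : ℕ}
    (S : Submodule K (Fin n → K)) : ℝ :=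
  familyHeight (fun a => ((Module.finBasis K S a : S) : Fin n → K))

theorem plucker_mul {R : Type*} [CommRing R] {d n : ℕ} (P : Matrix (Fin d) (Fin d) R)
    (X : Fin d → Fin n → R) (I : Fin d ↪o Fin n) :
    plucker (fun a j => ∑ c, P a c * X c j) I = P.det * plucker X I := by
  unfold plucker
  rw [← Matrix.det_mul]
  congr 1

theorem wedgeNorm_mul {𝕜 : Type*} [RCLike 𝕜] {d n : ℕ} (P : Matrix (Fin d) (Fin d) 𝕜)
    (X : Fin d → Fin n → 𝕜) :
    wedgeNorm (fun a j => ∑ c, P a c * X c j) = ‖P.det‖ * wedgeNorm X := by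
  unfold wedgeNorm
  simp only [plucker_mul, norm_mul, mul_pow]
  rw [← Finset.mul_sum, Real.sqrt_mul (by positivity), Real.sqrt_sq (norm_nonneg _)]

theorem familyHeight_mul {K : Type*} [Field K] [NumberField K] {d n : ℕ}
    (P : Matrix (Fin d) (Fin d) K) (hP : P.det ≠ 0) (X : Fin d → Fin n → K) :
    familyHeight (fun a j => ∑ c, P a c * X c j) = familyHeight X := by
  have hideal : FractionalIdeal.spanFinset (𝓞 K) Finset.univ
      (plucker (fun a j => ∑ c, P a c * X c j)) =
      FractionalIdeal.spanSingleton (nonZeroDivisors (𝓞 K)) P.det *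
        FractionalIdeal.spanFinset (𝓞 K) Finset.univ (plucker X) := by
    apply FractionalIdeal.coeToSubmodule_injective
    simp only [FractionalIdeal.coe_mul, FractionalIdeal.spanFinset_coe,
      FractionalIdeal.coe_spanSingleton, Submodule.span_mul_span, Set.singleton_mul]
    congr 1
    ext z
    simp [plucker_mul]
  have hnorm : ∏ σ : K →+* ℂ, ‖σ P.det‖ = |((Algebra.norm ℚ P.det : ℚ) : ℝ)| := by
    have h1 := Algebra.norm_eq_prod_embeddings ℚ ℂ P.det
    have h2 : ∏ σ : K →+* ℂ, ‖σ P.det‖ = ∏ σ : K →ₐ[ℚ] ℂ, ‖σ P.det‖ :=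
      Fintype.prod_equiv (RingHom.equivRatAlgHom K ℂ) _ _ (fun _ => rfl)
    rw [h2, ← norm_prod, ← h1, eq_ratCast, ← Complex.ofReal_ratCast, Complex.norm_real,
      Real.norm_eq_abs]
  have hwedge : ∀ σ : K →+* ℂ, wedgeNorm (fun a j => σ (∑ c, P a c * X c j)) =
      ‖σ P.det‖ * wedgeNorm (fun a j => σ (X a j)) := by
    intro σ
    have := wedgeNorm_mul (σ.mapMatrix P) (fun a j => σ (X a j))
    rw [← RingHom.map_det] at this
    rw [← this]
    simp [RingHom.mapMatrix_apply]
  have hne : |((Algebra.norm ℚ P.det : ℚ) : ℝ)| ≠ 0 := by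
    simpa [Algebra.norm_eq_zero_iff] using hP
  unfold familyHeight
  rw [hideal, map_mul, FractionalIdeal.absNorm_span_singleton]
  simp only [hwedge]
  rw [Finset.prod_mul_distrib, hnorm]
  push_cast
  field_simp

/-- The height of a subspace may be computed from any basis. -/
theorem subspaceHeight_eq {K : Type*} [Field K] [NumberField K] {d n : ℕ}
    (S : Submodule K (Fin n → K)) (b : Module.Basis (Fin d) K S) :
    subspaceHeight S = familyHeight (fun a => ((b a : S) : Fin n → K)) := by
  obtain rfl : Module.finrank K S = d := by simpa using Module.finrank_eq_card_basis b
  have hdet : (b.toMatrix (Module.finBasis K S)).transpose.det ≠ 0 := by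
    rw [Matrix.det_transpose]
    intro h0
    have := congrArg Matrix.det (b.toMatrix_mul_toMatrix_flip (Module.finBasis K S))
    rw [Matrix.det_mul, h0] at this
    simp at this
  rw [subspaceHeight, ← familyHeight_mul _ hdet (fun a => ((b a : S) : Fin n → K))]
  congr 1
  funext a j
  have h := congrArg (fun v : S => (v : Fin n → K) j)
    (b.sum_toMatrix_smul_self (Module.finBasis K S) a)
  refine h.symm.trans ?_
  simp [Matrix.transpose_apply, -Module.Basis.sum_toMatrix_smul_self]

/-! ### Subspaces defined over an embedded number field -/

/-- The vector of `𝕜ⁿ` given by a vector of `Kⁿ` through the embedding `ι`. -/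
def embVec {𝕜 : Type*} [RCLike 𝕜] {K : Type*} [Field K] (ι : K →+* 𝕜) {n : ℕ}
    (x : Fin n → K) : EuclideanSpace 𝕜 (Fin n) :=
  WithLp.toLp 2 (fun j => ι (x j))

/-- `B` is defined over `K`: it is spanned by vectors with coordinates in `K`. -/
def DefinedOver {𝕜 : Type*} [RCLike 𝕜] {K : Type*} [Field K] (ι : K →+* 𝕜) {n : ℕ}
    (B : Submodule 𝕜 (EuclideanSpace 𝕜 (Fin n))) : Prop :=
  ∃ s : Set (Fin n → K), Submodule.span 𝕜 (embVec ι '' s) = B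

/-- The subspace `B ∩ Kⁿ` of `Kⁿ`. -/
def ratPoints {𝕜 : Type*} [RCLike 𝕜] {K : Type*} [Field K] (ι : K →+* 𝕜) {n : ℕ}
    (B : Submodule 𝕜 (EuclideanSpace 𝕜 (Fin n))) : Submodule K (Fin n → K) where
  carrier := {x | embVec ι x ∈ B}
  add_mem' := by
    intro x y hx hy
    have h : embVec ι (x + y) = embVec ι x + embVec ι y := by
      ext j
      simp [embVec]
    simpa [h] using B.add_mem hx hy
  zero_mem' := by
    have h : embVec ι (0 : Fin n → K) = 0 := by
      ext j
      simp [embVec]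
    simp [h]
  smul_mem' := by
    intro a x hx
    have h : embVec ι (a • x) = ι a • embVec ι x := by
      ext j
      simp [embVec]
    simpa [h] using B.smul_mem (ι a) hx

/-- The height `H(B)` of a subspace `B` of `𝕜ⁿ` defined over `K`: the height of `B ∩ Kⁿ`. -/
def height {𝕜 : Type*} [RCLike 𝕜] {K : Type*} [Field K] [NumberField K] (ι : K →+* 𝕜) {n : ℕ}
    (B : Submodule 𝕜 (EuclideanSpace 𝕜 (Fin n))) : ℝ :=
  subspaceHeight (ratPoints ι B)

end GoingDown

end

/-! ### Minkowski's theorem over the infinite places. -/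

noncomputable section
namespace GoingDown

open MeasureTheory NumberField

/-! A hyperplane of B^e defined over K is the kernel of a K-linear functional on B ∩ Kⁿ, so it is
found by choosing the values φ of the functional on a basis X of integral vectors. Its Grassmann
coordinates are the contraction of X_1 ∧ … ∧ X_e with φ (`exists_plucker_eq_contraction`), so its
height is bounded by the Grassmann coordinates of X times the sizes of the functional at the
infinite places. The lattice of integral points need not be free, but X can be taken with minors
generating an ideal of bounded norm (`exists_almost_free_basis`), and then the coordinates of X
measure H(B).

Minkowski's theorem (`exists_integral_small_forms`) gives a non-zero integral φ of size at most T at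
every infinite place and, at the place v₀ of the embedding, at most T δ_j at the j-th vector of a
given orthonormal basis Z of B, as soon as C ≤ H(B) R^e ∏ δ_j^q, where R = T^[K:ℚ]. If N ≤ T is the
largest absolute value actually taken on Z, the kernel has height at most C H(B) R (N/T)^q. This is
`exists_hyperplane_small`, with ρ = T/N.

For the closeness, take principal directions x_1, …, x_d of A with respect to B, the closest ones
first (`exists_orthonormal_close`), and let Z come from their projections to B by Gram–Schmidt, so
that the projection of x_j involves only Z_1, …, Z_j. Scaled to maximum 1 on Z, the functional is at
most ρ δ_i on Z_1, …, Z_i, because δ increases. Hence the projection of any vector in the span of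
x_1, …, x_i can be moved into the kernel with relative error O(ρ δ_i), and ω_i(A, B') ≪ ω_i(A, B) +
ρ δ_i (`omega_inf_ker_le`). The loss ρ^q is exactly the gain in the height, which gives

H(B') ω_i(A, B')^q ≪ H(B) R (ω_i(A, B)^q + δ_i^q) (`exists_going_down_step`).

Both parts of the theorem are choices of R and δ. In Part 1, H(B) δ_i^q = H^(1 - q y_i) matches the
hypothesis on ω_i up to c^q. In Part 2 all δ_i are equal and as small as Minkowski's condition
permits. -/

theorem volume_linear_forms_real {e : ℕ} (M : Matrix (Fin e) (Fin e) ℝ) (hM : M.det ≠ 0)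
    (t : Fin e → ℝ) (ht : ∀ j, 0 < t j) :
    ENNReal.ofReal (‖M.det‖⁻¹ * ∏ j, t j) ≤
      volume {x : Fin e → ℝ | ∀ j, ‖∑ a, M j a * x a‖ < t j} := by
  have hset : {x : Fin e → ℝ | ∀ j, ‖∑ a, M j a * x a‖ < t j} =
      (Matrix.toLin' M) ⁻¹' (Set.univ.pi fun j => Metric.ball 0 (t j)) := by
    ext x
    simp [Matrix.mulVec, dotProduct]
  rw [hset, Measure.addHaar_preimage_linearMap _ (by simpa using hM), volume_pi_pi]
  simp only [Real.volume_ball, LinearMap.det_toLin', abs_inv]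
  rw [ENNReal.ofReal_mul (by positivity), ENNReal.ofReal_prod_of_nonneg fun j _ => (ht j).le,
    Real.norm_eq_abs]
  gcongr with j
  linarith [ht j]

/-- The real determinant of a complex linear map is |det|², whence the square, which is the
multiplicity of a complex place. As over ℝ, the set is the preimage of a product of balls, and a
lower bound suffices, so the factors π are dropped. -/
theorem volume_linear_forms_complex {e : ℕ} (M : Matrix (Fin e) (Fin e) ℂ) (hM : M.det ≠ 0)
    (t : Fin e → ℝ) (ht : ∀ j, 0 < t j) :
    ENNReal.ofReal ((‖M.det‖⁻¹ * ∏ j, t j) ^ 2) ≤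
      volume {x : Fin e → ℂ | ∀ j, ‖∑ a, M j a * x a‖ < t j} := by
  have hset : {x : Fin e → ℂ | ∀ j, ‖∑ a, M j a * x a‖ < t j} =
      ((Matrix.toLin' M).restrictScalars ℝ) ⁻¹' (Set.univ.pi fun j => Metric.ball 0 (t j)) := by
    ext x
    simp [Matrix.mulVec, dotProduct]
  have hdet : LinearMap.det ((Matrix.toLin' M).restrictScalars ℝ) = ‖M.det‖ ^ 2 := by
    rw [LinearMap.det_restrictScalars, Algebra.norm_complex_apply, LinearMap.det_toLin',
      Complex.normSq_eq_norm_sq]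
  rw [hset, Measure.addHaar_preimage_linearMap _ (by rw [hdet]; positivity), volume_pi_pi, hdet,
    mul_pow, ← Finset.prod_pow, ENNReal.ofReal_mul (by positivity),
    ENNReal.ofReal_prod_of_nonneg fun j _ => by positivity, abs_of_nonneg (by positivity), inv_pow]
  gcongr with j
  rw [Complex.volume_ball, ENNReal.ofReal_pow (ht j).le]
  refine le_mul_of_one_le_right' ?_
  have : (1 : NNReal) ≤ NNReal.pi := by
    rw [← NNReal.coe_le_coe]
    simpa using (by norm_num : (1 : ℝ) ≤ 2).trans Real.two_le_pi
  exact_mod_cast this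

variable (K : Type*) [Field K] [NumberField K]

/-- The mixed space `∏_v K_v^e` of a number field, arranged place by place. -/
abbrev MixedVec (e : ℕ) : Type _ :=
  ({w : InfinitePlace K // w.IsReal} → Fin e → ℝ) ×
    ({w : InfinitePlace K // w.IsComplex} → Fin e → ℂ)

/-- `(K_ℝ)^e` rearranged place by place. -/
def mixedVecEquiv (e : ℕ) : (Fin e → mixedEmbedding.mixedSpace K) ≃ₗ[ℝ] MixedVec K e where
  toFun x := (fun w a => (x a).1 w, fun w a => (x a).2 w)
  invFun x a := (fun w => x.1 w a, fun w => x.2 w a)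
  map_add' _ _ := rfl
  map_smul' _ _ := rfl
  left_inv _ := rfl
  right_inv _ := rfl

/-- A real basis of `∏_v K_v^e` spanning the lattice of integral vectors. -/
def mixedVecBasis (e : ℕ) :=
  (Pi.basis fun _ : Fin e => mixedEmbedding.latticeBasis K).map (mixedVecEquiv K e)

theorem exists_eq_of_mem_span_mixedVecBasis {e : ℕ} {x : MixedVec K e}
    (hx : x ∈ Submodule.span ℤ (Set.range (mixedVecBasis K e))) :
    ∃ φ : Fin e → 𝓞 K, x = mixedVecEquiv K e fun a => mixedEmbedding K (φ a) := by
  classical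
  induction hx using Submodule.span_induction with
  | mem x hx =>
    obtain ⟨⟨a, i⟩, rfl⟩ := hx
    refine ⟨Pi.single a (RingOfIntegers.basis K i), ?_⟩
    simp only [mixedVecBasis, Module.Basis.map_apply, Pi.basis_apply]
    congr 1
    funext b
    by_cases hb : b = a
    · subst hb
      simp [mixedEmbedding.latticeBasis_apply, integralBasis_apply]
    · simp [hb]
  | zero => exact ⟨0, by simp; rfl⟩
  | add x y _ _ hx hy =>
    obtain ⟨φ, rfl⟩ := hx
    obtain ⟨ψ, rfl⟩ := hy
    refine ⟨φ + ψ, ?_⟩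
    rw [← map_add]
    congr 1
    funext a
    simp
  | smul c x _ hx =>
    obtain ⟨φ, rfl⟩ := hx
    refine ⟨c • φ, ?_⟩
    rw [← map_zsmul]
    congr 1
    funext a
    simp

/-- Minkowski's theorem on linear forms over the infinite places of a number field. -/
theorem exists_integral_small_forms (e : ℕ) : ∃ C : ℝ, 0 < C ∧
    ∀ M : InfinitePlace K → Matrix (Fin e) (Fin e) ℂ,
      (∀ v : InfinitePlace K, v.IsReal → ∀ i j, (M v i j).im = 0) → (∀ v, (M v).det ≠ 0) →
      ∀ t : InfinitePlace K → Fin e → ℝ, (∀ v j, 0 < t v j) →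
        C < ∏ v, (‖(M v).det‖⁻¹ * ∏ j, t v j) ^ v.mult →
        ∃ φ : Fin e → 𝓞 K, φ ≠ 0 ∧
          ∀ (v : InfinitePlace K) (j : Fin e), ‖∑ a, M v j a * v.embedding (φ a)‖ < t v j := by
  classical
  have hfin : volume (ZSpan.fundamentalDomain (mixedVecBasis K e)) < ⊤ :=
    (ZSpan.fundamentalDomain_isBounded _).measure_lt_top
  -- Minkowski's threshold: covolume times 2 to the real dimension. One is added to it below only to
  -- make the constant positive.
  set c := volume (ZSpan.fundamentalDomain (mixedVecBasis K e)) *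
    2 ^ (Module.finrank ℝ (MixedVec K e)) with hc
  have hcfin : c ≠ ⊤ := ENNReal.mul_ne_top hfin.ne (by simp)
  refine ⟨c.toReal + 1, by positivity, fun M hreal hdet t ht hC => ?_⟩
  -- At a real place the local factor of the mixed space is ℝ^e, so the matrix, whose entries have
  -- imaginary part 0, is replaced by its real part.
  let N : InfinitePlace K → Matrix (Fin e) (Fin e) ℝ := fun v => (M v).map Complex.re
  have hN : ∀ v : InfinitePlace K, v.IsReal → M v = (N v).map Complex.ofReal := by
    intro v hv
    ext i j
    exact Complex.ext (by simp [N]) (by simp [N, hreal v hv])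
  have hNdet : ∀ v : InfinitePlace K, v.IsReal → (M v).det = ((N v).det : ℂ) := by
    intro v hv
    rw [hN v hv]
    exact (RingHom.map_det Complex.ofRealHom (N v)).symm
  let s : Set (MixedVec K e) :=
    (Set.univ.pi fun w => {x | ∀ j, ‖∑ a, N w.1 j a * x a‖ < t w.1 j}) ×ˢ
      (Set.univ.pi fun w => {x | ∀ j, ‖∑ a, M w.1 j a * x a‖ < t w.1 j})
  have hvol : c < volume s := by
    have h1 : ENNReal.ofReal (∏ v, (‖(M v).det‖⁻¹ * ∏ j, t v j) ^ v.mult) ≤ volume s := by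
      have hnn : ∀ v : InfinitePlace K, 0 ≤ (‖(M v).det‖⁻¹ * ∏ j, t v j) := fun v =>
        mul_nonneg (by positivity) (Finset.prod_nonneg fun j _ => (ht v j).le)
      rw [InfinitePlace.prod_eq_prod_mul_prod, Measure.volume_eq_prod, Measure.prod_prod,
        volume_pi_pi, volume_pi_pi,
        ENNReal.ofReal_mul (Finset.prod_nonneg fun v _ => pow_nonneg (hnn _) _),
        ENNReal.ofReal_prod_of_nonneg fun v _ => pow_nonneg (hnn _) _,
        ENNReal.ofReal_prod_of_nonneg fun v _ => pow_nonneg (hnn _) _]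
      gcongr with w _ w _
      · rw [InfinitePlace.mult_isReal, pow_one]
        have h := volume_linear_forms_real (N w.1) (by simpa [hNdet w.1 w.2] using hdet w.1)
          (t w.1) (ht w.1)
        simpa [hNdet w.1 w.2] using h
      · rw [InfinitePlace.mult_isComplex]
        exact volume_linear_forms_complex (M w.1) (hdet w.1) (t w.1) (ht w.1)
    refine lt_of_lt_of_le ?_ h1
    rw [← ENNReal.ofReal_toReal hcfin, ENNReal.ofReal_lt_ofReal_iff']
    constructor <;> linarith [ENNReal.toReal_nonneg (a := c)]
  have hsymm : ∀ x ∈ s, -x ∈ s := by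
    rintro x ⟨h1, h2⟩
    refine ⟨fun w _ j => ?_, fun w _ j => ?_⟩
    · simpa using h1 w trivial j
    · simpa using h2 w trivial j
  have hconv : Convex ℝ s := by
    refine Convex.prod (convex_pi fun w _ => ?_) (convex_pi fun w _ => ?_)
    · have : {x : Fin e → ℝ | ∀ j, ‖∑ a, N w.1 j a * x a‖ < t w.1 j} =
        (Matrix.toLin' (N w.1)) ⁻¹' (Set.univ.pi fun j => Metric.ball 0 (t w.1 j)) := by
        ext x
        simp [Matrix.mulVec, dotProduct]
      rw [this]
      exact (convex_pi fun j _ => convex_ball _ _).linear_preimage _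
    · have : {x : Fin e → ℂ | ∀ j, ‖∑ a, M w.1 j a * x a‖ < t w.1 j} =
        ((Matrix.toLin' (M w.1)).restrictScalars ℝ) ⁻¹'
          (Set.univ.pi fun j => Metric.ball 0 (t w.1 j)) := by
        ext x
        simp [Matrix.mulVec, dotProduct]
      rw [this]
      exact (convex_pi fun j _ => convex_ball _ _).linear_preimage _
  have : Measure.IsAddHaarMeasure (volume : Measure (MixedVec K e)) := by
    have h1 : Measure.IsAddHaarMeasure
        (volume : Measure ({w : InfinitePlace K // w.IsReal} → Fin e → ℝ)) :=
      Measure.pi.isAddHaarMeasure fun _ => volume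
    have h2 : Measure.IsAddHaarMeasure
        (volume : Measure ({w : InfinitePlace K // w.IsComplex} → Fin e → ℂ)) :=
      Measure.pi.isAddHaarMeasure fun _ => volume
    exact Measure.prod.instIsAddHaarMeasure _ _
  have : Countable (Submodule.span ℤ (Set.range (mixedVecBasis K e))).toAddSubgroup :=
    inferInstanceAs (Countable (Submodule.span ℤ (Set.range (mixedVecBasis K e))))
  obtain ⟨⟨x, hx⟩, hx0, hxs⟩ := exists_ne_zero_mem_lattice_of_measure_mul_two_pow_lt_measure
    (ZSpan.isAddFundamentalDomain' (mixedVecBasis K e) volume) hsymm hconv hvol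
  obtain ⟨φ, rfl⟩ := exists_eq_of_mem_span_mixedVecBasis K hx
  refine ⟨φ, ?_, fun v j => ?_⟩
  · rintro rfl
    apply hx0
    ext1
    simp
    rfl
  · by_cases hv : v.IsReal
    · have h := hxs.1 ⟨v, hv⟩ trivial j
      rw [hN v hv]
      simp only [mixedVecEquiv, LinearEquiv.coe_mk] at h
      rw [← Complex.norm_real] at h
      simpa [mixedEmbedding] using h
    · have h := hxs.2 ⟨v, InfinitePlace.not_isReal_iff_isComplex.1 hv⟩ trivial j
      simpa [mixedVecEquiv] using h

end GoingDown
end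

noncomputable section
namespace GoingDown

/-! ### Determinants and minors -/

section Minors

variable {R : Type*} [CommRing R] {d n : ℕ}

/-- A repeated column kills the determinant; otherwise sorting the columns yields a genuine minor up
to the sign of the permutation. -/
theorem det_eq_zero_or_plucker (X : Fin d → Fin n → R) (f : Fin d → Fin n) :
    Matrix.det (Matrix.of fun a b => X a (f b)) = 0 ∨ ∃ I : Fin d ↪o Fin n,
      Matrix.det (Matrix.of fun a b => X a (f b)) = plucker X I ∨
      Matrix.det (Matrix.of fun a b => X a (f b)) = -plucker X I := by
  by_cases hf : Function.Injective f
  · right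
    have hmono : StrictMono (f ∘ Tuple.sort f) :=
      (Tuple.monotone_sort f).strictMono_of_injective (hf.comp (Equiv.injective _))
    refine ⟨OrderEmbedding.ofStrictMono _ hmono, ?_⟩
    have h := Matrix.det_permute' (Tuple.sort f) (Matrix.of fun a b => X a (f b))
    have h' : plucker X (OrderEmbedding.ofStrictMono _ hmono) =
        ((Matrix.of fun a b => X a (f b)).submatrix id (Tuple.sort f)).det := rfl
    rw [h', h]
    rcases Int.units_eq_one_or (Equiv.Perm.sign (Tuple.sort f)) with hs | hs <;> simp [hs]
  · left
    simp only [Function.Injective, not_forall] at hf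
    obtain ⟨i, j, hij, hne⟩ := hf
    exact Matrix.det_zero_of_column_eq hne fun a => by simp [hij]

/-- A coarse form of the Cauchy–Binet formula. -/
theorem det_mul_eq_sum (X : Fin d → Fin n → R) (c : Fin n → Fin d → R) :
    Matrix.det (Matrix.of fun a b => ∑ j, X a j * c j b) =
      ∑ f : Fin d → Fin n, (∏ b, c (f b) b) * Matrix.det (Matrix.of fun a b => X a (f b)) := by
  rw [← Matrix.det_transpose]
  have h1 : (Matrix.of fun a b => ∑ j, X a j * c j b).transpose =
      fun b => ∑ j, c j b • fun a => X a j := by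
    ext b a
    simp [mul_comm]
  rw [h1]
  change Matrix.detRowAlternating.toMultilinearMap (fun b => ∑ j, c j b • fun a => X a j) = _
  rw [MultilinearMap.map_sum]
  refine Finset.sum_congr rfl fun f _ => ?_
  rw [MultilinearMap.map_smul_univ, smul_eq_mul]
  congr 1
  exact Matrix.det_transpose (Matrix.of fun a b => X a (f b))

theorem det_mul_mem_span_plucker (X : Fin d → Fin n → R) (c : Fin n → Fin d → R) :
    Matrix.det (Matrix.of fun a b => ∑ j, X a j * c j b) ∈
      Ideal.span (Set.range (plucker X)) := by
  rw [det_mul_eq_sum]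
  refine Ideal.sum_mem _ fun f _ => Ideal.mul_mem_left _ _ ?_
  rcases det_eq_zero_or_plucker X f with h | ⟨I, h | h⟩ <;> rw [h]
  · exact Ideal.zero_mem _
  · exact Ideal.subset_span ⟨I, rfl⟩
  · exact neg_mem (Ideal.subset_span ⟨I, rfl⟩)

/-- The coordinates of the contraction of `X₁ ∧ ⋯ ∧ X_{k+1}` with the functional taking the values
`φ` on the `X_a`. -/
def contraction {k : ℕ} (φ : Fin (k + 1) → R) (X : Fin (k + 1) → Fin n → R)
    (J : Fin k ↪o Fin n) : R :=
  Matrix.det (Matrix.of fun a => (Fin.cons (φ a) fun b => X a (J b) : Fin (k + 1) → R))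

/-- The augmented matrix (φ | X_J) is multiplied by U as a whole. Contractions can therefore be
computed in whichever basis is convenient. -/
theorem contraction_mul {k : ℕ} (U : Matrix (Fin (k + 1)) (Fin (k + 1)) R) (ψ : Fin (k + 1) → R)
    (Z : Fin (k + 1) → Fin n → R) (J : Fin k ↪o Fin n) :
    contraction (fun a => ∑ c, U a c * ψ c) (fun a j => ∑ c, U a c * Z c j) J =
      U.det * contraction ψ Z J := by
  unfold contraction
  rw [← Matrix.det_mul]
  congr 1
  ext a b
  refine Fin.cases ?_ (fun b => ?_) b <;> simp [Matrix.mul_apply]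

theorem map_plucker {S : Type*} [CommRing S] (g : R →+* S) (X : Fin d → Fin n → R)
    (I : Fin d ↪o Fin n) : g (plucker X I) = plucker (fun a j => g (X a j)) I := by
  simp only [plucker, RingHom.map_det]
  rfl

theorem map_contraction {S : Type*} [CommRing S] (g : R →+* S) {k : ℕ} (φ : Fin (k + 1) → R)
    (X : Fin (k + 1) → Fin n → R) (J : Fin k ↪o Fin n) :
    g (contraction φ X J) = contraction (fun a => g (φ a)) (fun a j => g (X a j)) J := by
  simp only [contraction, RingHom.map_det]
  congr 1
  ext a b
  refine Fin.cases ?_ (fun b => ?_) b <;> simp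

/-- If the functional takes the values `1, 0, …, 0`, the contraction drops the first vector. -/
theorem contraction_single {k : ℕ} (X : Fin (k + 1) → Fin n → R) (J : Fin k ↪o Fin n) (r : R) :
    contraction (Pi.single 0 r) X J = r * plucker (fun a => X a.succ) J := by
  unfold contraction
  rw [Matrix.det_succ_column_zero, Fin.sum_univ_succ]
  simp only [Matrix.of_apply, Fin.cons_zero]
  rw [Finset.sum_eq_zero fun i _ => by simp]
  simp [plucker, Matrix.submatrix]

end Minors

/-! ### Bounds for determinants, minors and contractions. -/

section Bounds

variable {L : Type*} [NormedField L]

theorem norm_det_le_of_columns {m : ℕ} (A : Matrix (Fin m) (Fin m) L) (b : Fin m → ℝ)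
    (hA : ∀ i j, ‖A i j‖ ≤ b j) : ‖A.det‖ ≤ m.factorial * ∏ j, b j := by
  rw [Matrix.det_apply]
  refine (norm_sum_le _ _).trans ?_
  have h : ∀ σ ∈ (Finset.univ : Finset (Equiv.Perm (Fin m))),
      ‖Equiv.Perm.sign σ • ∏ i, A (σ i) i‖ ≤ ∏ j, b j := by
    intro σ _
    have : ‖Equiv.Perm.sign σ • ∏ i, A (σ i) i‖ = ∏ i, ‖A (σ i) i‖ := by
      rw [← norm_prod]
      rcases Int.units_eq_one_or (Equiv.Perm.sign σ) with hs | hs <;> simp [hs]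
    rw [this]
    exact Finset.prod_le_prod (fun _ _ => norm_nonneg _) fun i _ => hA _ _
  refine (Finset.sum_le_sum h).trans ?_
  simp [Fintype.card_perm]

/-- The values of the functional fill a single column, so the bound is linear in N. -/
theorem norm_contraction_le {k n : ℕ} (ψ : Fin (k + 1) → L) (Z : Fin (k + 1) → Fin n → L)
    (hZ : ∀ a j, ‖Z a j‖ ≤ 1) {N : ℝ} (hN : ∀ a, ‖ψ a‖ ≤ N) (J : Fin k ↪o Fin n) :
    ‖contraction ψ Z J‖ ≤ (k + 1).factorial * N := by
  unfold contraction
  refine (norm_det_le_of_columns _ (Fin.cons N fun _ => 1) fun i j => ?_).trans ?_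
  · refine Fin.cases ?_ (fun b => ?_) j
    · simpa using hN i
    · simpa using hZ i (J b)
  · simp [Fin.prod_univ_succ]

theorem norm_plucker_le_factorial {d n : ℕ} (Z : Fin d → Fin n → L) (hZ : ∀ a j, ‖Z a j‖ ≤ 1)
    (I : Fin d ↪o Fin n) : ‖plucker Z I‖ ≤ d.factorial := by
  refine (norm_det_le_of_columns (Matrix.of fun a b => Z a (I b)) (fun _ => 1)
    fun i j => hZ i (I j)).trans ?_
  simp

theorem norm_det_select_le {d n : ℕ} (X : Fin d → Fin n → L) {W : ℝ} (hW0 : 0 ≤ W)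
    (hW : ∀ I, ‖plucker X I‖ ≤ W) (f : Fin d → Fin n) :
    ‖Matrix.det (Matrix.of fun a b => X a (f b))‖ ≤ W := by
  rcases det_eq_zero_or_plucker X f with h | ⟨I, h | h⟩ <;> rw [h]
  · simpa using hW0
  · exact hW I
  · simpa using hW I

theorem norm_det_mul_le {d n : ℕ} (X : Fin d → Fin n → L) (c : Fin n → Fin d → L)
    (hc : ∀ j b, ‖c j b‖ ≤ 1) {W : ℝ} (hW0 : 0 ≤ W) (hW : ∀ I, ‖plucker X I‖ ≤ W) :
    ‖Matrix.det (Matrix.of fun a b => ∑ j, X a j * c j b)‖ ≤ n ^ d * W := by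
  rw [det_mul_eq_sum]
  refine (norm_sum_le _ _).trans ?_
  have h : ∀ f ∈ (Finset.univ : Finset (Fin d → Fin n)),
      ‖(∏ b, c (f b) b) * Matrix.det (Matrix.of fun a b => X a (f b))‖ ≤ W := by
    intro f _
    rw [norm_mul, norm_prod]
    have h1 : ∏ b, ‖c (f b) b‖ ≤ 1 :=
      Finset.prod_le_one (fun _ _ => norm_nonneg _) fun b _ => hc _ _
    calc _ ≤ 1 * W := by
          gcongr
          exact norm_det_select_le X hW0 hW f
      _ = W := one_mul W
  refine (Finset.sum_le_sum h).trans ?_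
  simp

/-- The coordinates of all columns with respect to the columns of a largest maximal minor are
bounded by one. -/
theorem norm_inv_mul_le_one {d n : ℕ} (X : Fin d → Fin n → L) (I : Fin d ↪o Fin n)
    (hI : plucker X I ≠ 0) (hmax : ∀ J, ‖plucker X J‖ ≤ ‖plucker X I‖) (a : Fin d) (j : Fin n) :
    ‖∑ c, (Matrix.of fun a b => X a (I b))⁻¹ a c * X c j‖ ≤ 1 := by
  set A : Matrix (Fin d) (Fin d) L := Matrix.of fun a b => X a (I b) with hA
  have hdet : A.det = plucker X I := rfl
  have h1 : ∑ c, A⁻¹ a c * X c j = (A⁻¹.mulVec fun c => X c j) a := rfl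
  -- Cramer's rule: the coordinate is a quotient whose numerator has one chosen column replaced by
  -- column j, hence is 0 or, up to sign, another maximal minor.
  have h2 : (A⁻¹.mulVec fun c => X c j) = (A.det)⁻¹ • A.cramer fun c => X c j := by
    rw [Matrix.inv_def, Ring.inverse_eq_inv', Matrix.smul_mulVec, Matrix.cramer_eq_adjugate_mulVec]
  rw [h1, h2, Pi.smul_apply, Matrix.cramer_apply, smul_eq_mul, norm_mul, norm_inv, hdet,
    inv_mul_le_iff₀ (norm_pos_iff.2 hI), mul_one]
  have h3 : A.updateCol a (fun c => X c j) =
      Matrix.of fun x b => X x (Function.update (I : Fin d → Fin n) a j b) := by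
    ext x b
    by_cases hb : b = a
    · subst hb
      simp
    · simp [hb, hA]
  rw [h3]
  exact norm_det_select_le X (norm_nonneg _) hmax _

end Bounds

section WedgeNorm

variable {𝕜 : Type*} [RCLike 𝕜] {d n : ℕ}

theorem norm_plucker_le_wedgeNorm (X : Fin d → Fin n → 𝕜) (I : Fin d ↪o Fin n) :
    ‖plucker X I‖ ≤ wedgeNorm X := by
  refine Real.le_sqrt_of_sq_le ?_
  exact Finset.single_le_sum (f := fun I => ‖plucker X I‖ ^ 2) (fun _ _ => by positivity)
    (Finset.mem_univ I)

theorem wedgeNorm_nonneg (X : Fin d → Fin n → 𝕜) : 0 ≤ wedgeNorm X := Real.sqrt_nonneg _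

theorem sqrt_sum_sq_le {ι : Type*} [Fintype ι] (f : ι → ℝ) {b : ℝ} (hb : 0 ≤ b)
    (hf : ∀ i, |f i| ≤ b) : √(∑ i, f i ^ 2) ≤ (Fintype.card ι + 1) * b := by
  rw [Real.sqrt_le_left (by positivity)]
  calc ∑ i, f i ^ 2 ≤ ∑ _i : ι, b ^ 2 := Finset.sum_le_sum fun i _ => sq_le_sq' (abs_le.1 (hf i)).1
        (abs_le.1 (hf i)).2
    _ = Fintype.card ι * b ^ 2 := by simp
    _ ≤ ((Fintype.card ι + 1) * b) ^ 2 := by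
      have : (0 : ℝ) ≤ Fintype.card ι := by positivity
      nlinarith [sq_nonneg b, mul_nonneg this (sq_nonneg b),
        mul_nonneg (mul_nonneg this this) (sq_nonneg b)]

theorem wedgeNorm_le (X : Fin d → Fin n → 𝕜) {b : ℝ} (hb : 0 ≤ b)
    (hX : ∀ I, ‖plucker X I‖ ≤ b) :
    wedgeNorm X ≤ (Fintype.card (Fin d ↪o Fin n) + 1) * b :=
  sqrt_sum_sq_le _ hb fun I => by simpa using hX I

end WedgeNorm

end GoingDown
end

noncomputable section
namespace GoingDown

/-! ### Almost free lattices -/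

/-- Only the X_a term of β z survives in the determinant with row a replaced. This controls the
exchange of one basis vector in `exists_almost_free_basis`. -/
theorem mul_plucker_update {R : Type*} [CommRing R] {d n : ℕ} (X : Fin d → Fin n → R) (a : Fin d)
    (z : Fin n → R) (β : R) (α : Fin d → R) (hz : β • z = ∑ b, α b • X b) (I : Fin d ↪o Fin n) :
    β * plucker (Function.update X a z) I = α a * plucker X I := by
  have h1 := Matrix.det_updateRow_sum (Matrix.of fun x b => X x (I b)) a α
  have h2 : (∑ k, α k • (Matrix.of fun x b => X x (I b)) k) = β • fun b => z (I b) := by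
    ext b
    have := congrFun hz (I b)
    simp only [Finset.sum_apply, Pi.smul_apply, smul_eq_mul] at this
    simp [this]
  rw [h2, Matrix.det_updateRow_smul] at h1
  rw [smul_eq_mul] at h1
  refine Eq.trans ?_ h1
  refine congrArg (β * ·) (congrArg Matrix.det ?_)
  ext x b
  by_cases hx : x = a
  · subst hx
    simp
  · simp [hx]

section Field

variable {F : Type*} [Field F] {d n : ℕ}

/-- An independent family has a left inverse, so 1 = det(identity) lies in the ideal generated by
the maximal minors. -/
theorem exists_plucker_ne_zero {X : Fin d → Fin n → F} (hX : LinearIndependent F X) :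
    ∃ I, plucker X I ≠ 0 := by
  classical
  by_contra! h
  have hinj : LinearMap.ker (Fintype.linearCombination F X) = ⊥ :=
    LinearMap.ker_eq_bot.2 hX.fintypeLinearCombination_injective
  obtain ⟨g, hg⟩ := LinearMap.exists_leftInverse_of_injective _ hinj
  have hval : ∀ a b, ∑ j, X a j * g (Pi.single j 1) b = (1 : Matrix (Fin d) (Fin d) F) a b := by
    intro a b
    have h1 : g (X a) = Pi.single a 1 := by
      have := LinearMap.congr_fun hg (Pi.single a 1)
      simpa [Fintype.linearCombination_apply_single] using this
    have h2 : X a = ∑ j, X a j • (Pi.single j 1 : Fin n → F) := by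
      ext i
      simp [Finset.sum_apply, Pi.single_apply]
    have h3 := congrFun h1 b
    rw [h2] at h3
    simp only [map_sum, map_smul, Finset.sum_apply, Pi.smul_apply, smul_eq_mul] at h3
    rw [h3, Matrix.one_apply, Pi.single_apply]
    simp [eq_comm]
  have hdet := det_mul_mem_span_plucker X fun j b => g (Pi.single j 1) b
  simp only [hval] at hdet
  have hbot : Ideal.span (Set.range (plucker X)) = ⊥ := by
    rw [Ideal.span_eq_bot]
    rintro _ ⟨I, rfl⟩
    exact h I
  rw [hbot] at hdet
  have : (Matrix.of fun a b => (1 : Matrix (Fin d) (Fin d) F) a b) = 1 := rfl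
  rw [this, Matrix.det_one] at hdet
  exact one_ne_zero hdet

theorem linearIndependent_of_plucker_ne_zero {X : Fin d → Fin n → F} {I : Fin d ↪o Fin n}
    (h : plucker X I ≠ 0) : LinearIndependent F X := by
  have h1 : LinearIndependent F (Matrix.of fun a b => X a (I b)).row :=
    Matrix.linearIndependent_rows_of_det_ne_zero h
  exact LinearIndependent.of_comp (LinearMap.funLeft F F I) h1

end Field

variable {K : Type*} [Field K] {d n : ℕ}

/-- The vector of `Kⁿ` given by an integral vector. -/
def toField (x : Fin n → 𝓞 K) : Fin n → K := fun j => (x j : K)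

theorem plucker_toField (X : Fin d → Fin n → 𝓞 K) (I : Fin d ↪o Fin n) :
    plucker (fun a => toField (X a)) I = ((plucker X I : 𝓞 K) : K) :=
  (map_plucker (algebraMap (𝓞 K) K) X I).symm

theorem linearIndependent_toField_iff {X : Fin d → Fin n → 𝓞 K} :
    LinearIndependent K (fun a => toField (X a)) ↔ ∃ I, plucker X I ≠ 0 := by
  constructor
  · intro h
    obtain ⟨I, hI⟩ := exists_plucker_ne_zero h
    rw [plucker_toField] at hI
    exact ⟨I, fun h0 => hI (by rw [h0]; simp)⟩
  · rintro ⟨I, hI⟩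
    refine linearIndependent_of_plucker_ne_zero (I := I) ?_
    rw [plucker_toField]
    simpa using hI

/-- The lattice of integral points of a subspace of `Kⁿ`. -/
def integralPoints (S : Submodule K (Fin n → K)) : Submodule (𝓞 K) (Fin n → 𝓞 K) where
  carrier := {x | toField x ∈ S}
  add_mem' {x y} hx hy := by
    have : toField (x + y) = toField x + toField y := by ext j; simp [toField]
    simpa [this] using S.add_mem hx hy
  zero_mem' := by
    have : toField (0 : Fin n → 𝓞 K) = 0 := by ext j; simp [toField]
    simp [this]
  smul_mem' r x hx := by
    have : toField (r • x) = (r : K) • toField x := by ext j; simp [toField]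
    simpa [this] using S.smul_mem (r : K) hx

theorem mem_integralPoints {S : Submodule K (Fin n → K)} {x : Fin n → 𝓞 K} :
    x ∈ integralPoints S ↔ toField x ∈ S := Iff.rfl

theorem toField_smul (r : 𝓞 K) (x : Fin n → 𝓞 K) : toField (r • x) = (r : K) • toField x := by
  ext j
  simp [toField]

variable [NumberField K]

/-- The integral points form a saturated sublattice: the quotient is torsion-free and finitely
generated over a Dedekind domain, hence projective, and the inclusion splits. -/
theorem exists_projection_integralPoints (S : Submodule K (Fin n → K)) :
    ∃ π : (Fin n → 𝓞 K) →ₗ[𝓞 K] (Fin n → 𝓞 K),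
      (∀ x, π x ∈ integralPoints S) ∧ ∀ x ∈ integralPoints S, π x = x := by
  set Λ := integralPoints S
  have htors : Submodule.torsion (𝓞 K) ((Fin n → 𝓞 K) ⧸ Λ) = ⊥ := by
    rw [eq_bot_iff]
    rintro m ⟨⟨r, hr⟩, h⟩
    obtain ⟨x, rfl⟩ := Λ.mkQ_surjective m
    rw [Submodule.mem_bot, Submodule.mkQ_apply, Submodule.Quotient.mk_eq_zero]
    have h' : Λ.mkQ (r • x) = 0 := by simpa using h
    rw [Submodule.mkQ_apply, Submodule.Quotient.mk_eq_zero, mem_integralPoints, toField_smul] at h'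
    have hr0 : (r : K) ≠ 0 := by simpa using nonZeroDivisors.ne_zero hr
    exact (S.smul_mem_iff hr0).1 h'
  have hflat : Module.Flat (𝓞 K) ((Fin n → 𝓞 K) ⧸ Λ) :=
    IsDedekindDomain.flat_iff_torsion_eq_bot.2 htors
  have hproj : Module.Projective (𝓞 K) ((Fin n → 𝓞 K) ⧸ Λ) :=
    have : Module.FinitePresentation (𝓞 K) ((Fin n → 𝓞 K) ⧸ Λ) :=
      Module.finitePresentation_of_finite _ _
    Module.Flat.projective_of_finitePresentation
  obtain ⟨s, hs⟩ := Module.projective_lifting_property Λ.mkQ LinearMap.id Λ.mkQ_surjective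
  refine ⟨LinearMap.id - s ∘ₗ Λ.mkQ, fun x => ?_, fun x hx => ?_⟩
  · rw [← Submodule.Quotient.mk_eq_zero, ← Submodule.mkQ_apply]
    have := LinearMap.congr_fun hs (Λ.mkQ x)
    simp only [LinearMap.comp_apply, LinearMap.id_apply] at this
    simp only [LinearMap.sub_apply, LinearMap.id_apply, LinearMap.comp_apply, map_sub]
    rw [this, sub_self]
  · have : Λ.mkQ x = 0 := by simpa using hx
    simp [this]

/-- If `D` maps the integral points of `S` into the span of `X`, then `D ^ d` lies in the ideal
generated by the maximal minors of `X`. -/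
theorem pow_mem_span_plucker (S : Submodule K (Fin n → K)) (X : Fin d → Fin n → 𝓞 K)
    (hXS : ∀ a, X a ∈ integralPoints S) (hX : ∃ I, plucker X I ≠ 0) (D : 𝓞 K)
    (hD : ∀ y ∈ integralPoints S, ∃ c : Fin d → 𝓞 K, D • y = ∑ b, c b • X b) :
    D ^ d ∈ Ideal.span (Set.range (plucker X)) := by
  classical
  obtain ⟨π, hπ, hπid⟩ := exists_projection_integralPoints S
  -- Applying D·π to the standard basis gives an integral matrix c with X c = D · 1. Its determinant
  -- D^d is then in the ideal of minors by Cauchy–Binet.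
  choose c hc using fun j : Fin n => hD _ (hπ (Pi.single j 1))
  have hli : LinearIndependent (𝓞 K) X := by
    have h1 := (linearIndependent_toField_iff.2 hX).restrict_scalars
      (R := 𝓞 K) (by intro a b hab; simpa [Algebra.smul_def] using hab)
    let f : (Fin n → 𝓞 K) →ₗ[𝓞 K] (Fin n → K) :=
      { toFun := toField
        map_add' := fun x y => by ext j; simp [toField]
        map_smul' := fun r x => by ext j; simp [toField, Algebra.smul_def] }
    exact LinearIndependent.of_comp f h1
  have hval : ∀ a, ∑ b, (∑ j, X a j * c j b) • X b = D • X a := by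
    intro a
    have h2 : X a = ∑ j, X a j • (Pi.single j 1 : Fin n → 𝓞 K) := by
      ext i
      simp [Finset.sum_apply, Pi.single_apply]
    conv_rhs => rw [← hπid _ (hXS a), h2]
    simp only [map_sum, map_smul, Finset.smul_sum, Finset.sum_smul]
    rw [Finset.sum_comm]
    refine Finset.sum_congr rfl fun j _ => ?_
    rw [smul_comm, hc j, Finset.smul_sum]
    simp only [smul_smul]
  have hmat : (Matrix.of fun a b => ∑ j, X a j * c j b) =
      D • (1 : Matrix (Fin d) (Fin d) (𝓞 K)) := by
    refine Matrix.ext fun a b => ?_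
    have h3 : ∑ b, (∑ j, X a j * c j b) • X b =
        ∑ b, (D • (Pi.single a 1 : Fin d → 𝓞 K)) b • X b := by
      rw [hval a]
      simp [Pi.single_apply, ite_smul]
    have h4 := congrFun (hli.fintypeLinearCombination_injective
      (a₁ := fun b => ∑ j, X a j * c j b) (a₂ := D • (Pi.single a 1 : Fin d → 𝓞 K)) h3) b
    refine h4.trans ?_
    simp [Matrix.one_apply, Pi.single_apply, eq_comm]
  have := det_mul_mem_span_plucker X c
  rw [hmat, Matrix.det_smul, Matrix.det_one, mul_one, Fintype.card_fin] at this
  exact this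

theorem exists_integral_multiple (x : Fin n → K) :
    ∃ r : 𝓞 K, r ≠ 0 ∧ ∃ y : Fin n → 𝓞 K, toField y = (r : K) • x := by
  obtain ⟨b, hb⟩ := IsLocalization.exist_integer_multiples_of_finite
    (nonZeroDivisors (𝓞 K)) (S := K) x
  choose y hy using hb
  refine ⟨b, nonZeroDivisors.ne_zero b.2, y, ?_⟩
  ext j
  simp only [toField, hy j]
  simp [Algebra.smul_def]

theorem exists_integral_family (S : Submodule K (Fin n → K)) (hS : Module.finrank K S = d) :
    ∃ X : Fin d → Fin n → 𝓞 K, (∀ a, X a ∈ integralPoints S) ∧ ∃ I, plucker X I ≠ 0 := by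
  let b := Module.finBasisOfFinrankEq K S hS
  choose r hr X hX using fun a => exists_integral_multiple ((b a : S) : Fin n → K)
  refine ⟨X, fun a => ?_, linearIndependent_toField_iff.1 ?_⟩
  · rw [mem_integralPoints, hX]
    exact S.smul_mem _ (b a).2
  · have h1 : LinearIndependent K fun a => ((b a : S) : Fin n → K) :=
      b.linearIndependent.map' S.subtype S.ker_subtype
    have h2 := h1.units_smul fun a => Units.mk0 (r a : K) (by simpa using hr a)
    convert h2 using 1
    funext a
    rw [hX]
    rfl

theorem exists_smul_eq_sum (S : Submodule K (Fin n → K)) (hS : Module.finrank K S = d)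
    (X : Fin d → Fin n → 𝓞 K) (hXS : ∀ a, X a ∈ integralPoints S) (hX : ∃ I, plucker X I ≠ 0)
    (y : Fin n → 𝓞 K) (hy : y ∈ integralPoints S) :
    ∃ β : 𝓞 K, β ≠ 0 ∧ ∃ α : Fin d → 𝓞 K, β • y = ∑ a, α a • X a := by
  have hli := linearIndependent_toField_iff.2 hX
  have hspan : Submodule.span K (Set.range fun a => toField (X a)) = S := by
    refine Submodule.eq_of_le_of_finrank_le ?_ ?_
    · rw [Submodule.span_le]
      rintro _ ⟨a, rfl⟩
      exact hXS a
    · rw [finrank_span_eq_card hli, hS]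
      simp
  have hy' : toField y ∈ Submodule.span K (Set.range fun a => toField (X a)) := by
    rw [hspan]
    exact hy
  obtain ⟨c, hc⟩ := (Submodule.mem_span_range_iff_exists_fun K).1 hy'
  obtain ⟨β, hβ, α, hα⟩ := exists_integral_multiple c
  refine ⟨β, hβ, α, ?_⟩
  have hinj : Function.Injective (toField : (Fin n → 𝓞 K) → Fin n → K) := by
    intro u v huv
    ext j
    exact congrFun huv j
  apply hinj
  rw [toField_smul, ← hc, Finset.smul_sum]
  ext j
  simp only [Finset.sum_apply, toField, smul_smul, map_sum, Pi.smul_apply, smul_eq_mul, map_mul]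
  refine Finset.sum_congr rfl fun a _ => ?_
  have := congrFun hα a
  simp only [toField, Pi.smul_apply, smul_eq_mul] at this
  exact congrArg (· * (X a j : K)) this.symm

/-- Every subspace of `Kⁿ` has a basis of integral vectors whose maximal minors generate an ideal
of bounded norm. -/
theorem exists_almost_free_basis (K : Type*) [Field K] [NumberField K] (d n : ℕ) :
    ∃ C : ℕ, ∀ S : Submodule K (Fin n → K), Module.finrank K S = d →
      ∃ X : Fin d → Fin n → 𝓞 K, (∀ a, X a ∈ integralPoints S) ∧ (∃ I, plucker X I ≠ 0) ∧
        Ideal.absNorm (Ideal.span (Set.range (plucker X))) ≤ C := by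
  classical
  let bS := NumberField.RingOfIntegers.basis K
  -- The finite set from the proof of finiteness of the class group: for all α and β ≠ 0 some r in
  -- it and some q satisfy |N(rα - qβ)| < |N(β)|. The product D is a common multiple of these r,
  -- independent of S.
  let D : 𝓞 K := ∏ r ∈ ClassGroup.finsetApprox bS AbsoluteValue.absIsAdmissible, (r : 𝓞 K)
  have hD0 : D ≠ 0 := by
    refine Finset.prod_ne_zero_iff.2 fun r hr h0 => ?_
    have : r = 0 := by exact_mod_cast h0
    exact ClassGroup.finsetApprox.zero_notMem bS AbsoluteValue.absIsAdmissible (this ▸ hr)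
  refine ⟨Ideal.absNorm (Ideal.span {D ^ d}), fun S hS => ?_⟩
  -- Among all integral families, X is taken with the ideal of minors of least norm.
  let P : ℕ → Prop := fun m => ∃ X : Fin d → Fin n → 𝓞 K, (∀ a, X a ∈ integralPoints S) ∧
    (∃ I, plucker X I ≠ 0) ∧ Ideal.absNorm (Ideal.span (Set.range (plucker X))) = m
  have hP : ∃ m, P m := by
    obtain ⟨X, h1, h2⟩ := exists_integral_family S hS
    exact ⟨_, X, h1, h2, rfl⟩
  obtain ⟨X, hXS, hX, hXm⟩ := Nat.find_spec hP
  have hmin : ∀ m, P m → Ideal.absNorm (Ideal.span (Set.range (plucker X))) ≤ m :=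
    fun m hm => hXm ▸ Nat.find_min' hP hm
  refine ⟨X, hXS, hX, ?_⟩
  have key : ∀ y ∈ integralPoints S, ∃ c : Fin d → 𝓞 K, D • y = ∑ b, c b • X b := by
    intro y hy
    obtain ⟨β, hβ, α, hα⟩ := exists_smul_eq_sum S hS X hXS hX y hy
    have hdvd : ∀ a, ∃ γ, D * α a = β * γ := by
      intro a
      obtain ⟨q, r, hr, hlt⟩ := ClassGroup.exists_mem_finset_approx' bS
        AbsoluteValue.absIsAdmissible (α a) hβ
      -- If the remainder γ were non-zero, replacing X_a by r y - q X_a would multiply the norm of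
      -- the ideal of minors by |N(γ)|/|N(β)| < 1, against minimality. So β divides r α_a, hence D
      -- α_a.
      have hzero : r • α a - q * β = 0 := by
        by_contra hne
        set γ := r • α a - q * β with hγ
        let z : Fin n → 𝓞 K := r • y - q • X a
        have hz : β • z = ∑ b, (Function.update (fun b => r • α b) a γ) b • X b := by
          have h1 : β • z = r • (β • y) - (q * β) • X a := by
            simp only [z, smul_sub, smul_smul, mul_comm q β]
            rw [smul_comm]
          rw [h1, hα, Finset.smul_sum, ← Finset.add_sum_erase _ _ (Finset.mem_univ a),
            ← Finset.add_sum_erase _ _ (Finset.mem_univ a), Function.update_self, hγ, sub_smul,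
            smul_assoc, add_sub_right_comm]
          congr 1
          refine Finset.sum_congr rfl fun b hb => ?_
          rw [Function.update_of_ne (Finset.ne_of_mem_erase hb), smul_assoc]
        have hpl := mul_plucker_update X a z β _ hz
        simp only [Function.update_self] at hpl
        have hideal : Ideal.span {β} * Ideal.span (Set.range (plucker (Function.update X a z))) =
            Ideal.span {γ} * Ideal.span (Set.range (plucker X)) := by
          rw [Ideal.span_mul_span', Ideal.span_mul_span']
          congr 1
          ext w
          simp [hpl]
        have hnorm := congrArg Ideal.absNorm hideal
        rw [map_mul, map_mul, Ideal.absNorm_span_singleton, Ideal.absNorm_span_singleton] at hnorm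
        obtain ⟨I, hI⟩ := hX
        have hle := hmin _ ⟨Function.update X a z, fun b => ?_, ⟨I, fun h0 => ?_⟩, rfl⟩
        · have hpos : 0 < Ideal.absNorm (Ideal.span (Set.range (plucker X))) := by
            rw [Nat.pos_iff_ne_zero, Ne, Ideal.absNorm_eq_zero_iff, Ideal.span_eq_bot]
            exact fun h => hI (h _ ⟨I, rfl⟩)
          have hlt' : (Algebra.norm ℤ γ).natAbs < (Algebra.norm ℤ β).natAbs := by
            zify
            exact hlt
          have : (Algebra.norm ℤ γ).natAbs * Ideal.absNorm (Ideal.span (Set.range (plucker X))) <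
              (Algebra.norm ℤ β).natAbs *
                Ideal.absNorm (Ideal.span (Set.range (plucker (Function.update X a z)))) :=
            calc _ < (Algebra.norm ℤ β).natAbs *
                    Ideal.absNorm (Ideal.span (Set.range (plucker X))) :=
                  Nat.mul_lt_mul_of_pos_right hlt' hpos
              _ ≤ _ := Nat.mul_le_mul_left _ hle
          omega
        · by_cases hb : b = a
          · subst hb
            rw [Function.update_self]
            refine sub_mem ?_ (Submodule.smul_mem _ _ (hXS _))
            exact zsmul_mem hy r
          · rw [Function.update_of_ne hb]
            exact hXS b
        · have := hpl I
          rw [h0, mul_zero, eq_comm, mul_eq_zero] at this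
          exact this.elim hne hI
      obtain ⟨s, hs⟩ : (r : 𝓞 K) ∣ D := Finset.dvd_prod_of_mem (fun r : ℤ => (r : 𝓞 K)) hr
      refine ⟨s * q, ?_⟩
      have : (r : 𝓞 K) * α a = q * β := by
        rw [← zsmul_eq_mul]
        exact sub_eq_zero.1 hzero
      rw [hs, mul_right_comm, this]
      ring
    choose γ hγ using hdvd
    refine ⟨γ, ?_⟩
    have h1 : β • (D • y) = β • ∑ b, γ b • X b := by
      rw [smul_comm, hα, Finset.smul_sum, Finset.smul_sum]
      simp only [smul_smul, hγ]
    ext1 j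
    have := congrFun h1 j
    simp only [Pi.smul_apply, smul_eq_mul] at this
    exact mul_left_cancel₀ hβ this
  have hmem := pow_mem_span_plucker S X hXS hX D key
  refine Nat.le_of_dvd ?_ (Ideal.absNorm_dvd_absNorm_of_le ?_)
  · rw [Nat.pos_iff_ne_zero, Ne, Ideal.absNorm_eq_zero_iff, Ideal.span_singleton_eq_bot]
    exact pow_ne_zero _ hD0
  · rwa [Ideal.span_singleton_le_iff_mem]

end GoingDown
end

noncomputable section
namespace GoingDown

/-! ### Heights place by place -/

open NumberField

variable {K : Type*} [Field K] {d n : ℕ}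

/-- The Euclidean norm of a vector at an infinite place. -/
def placeNorm (v : InfinitePlace K) {ι : Type*} [Fintype ι] (p : ι → K) : ℝ :=
  √(∑ i, v (p i) ^ 2)

theorem placeNorm_nonneg (v : InfinitePlace K) {ι : Type*} [Fintype ι] (p : ι → K) :
    0 ≤ placeNorm v p := Real.sqrt_nonneg _

theorem le_placeNorm (v : InfinitePlace K) {ι : Type*} [Fintype ι] (p : ι → K) (i : ι) :
    v (p i) ≤ placeNorm v p := by
  refine Real.le_sqrt_of_sq_le ?_
  exact Finset.single_le_sum (f := fun i => v (p i) ^ 2) (fun _ _ => by positivity)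
    (Finset.mem_univ i)

theorem placeNorm_le (v : InfinitePlace K) {ι : Type*} [Fintype ι] (p : ι → K) {b : ℝ}
    (hb : 0 ≤ b) (hp : ∀ i, v (p i) ≤ b) : placeNorm v p ≤ (Fintype.card ι + 1) * b :=
  sqrt_sum_sq_le _ hb fun i => by
    rw [abs_of_nonneg (apply_nonneg v _)]
    exact hp i

theorem wedgeNorm_map_eq_placeNorm (σ : K →+* ℂ) (X : Fin d → Fin n → K) :
    wedgeNorm (fun a j => σ (X a j)) = placeNorm (InfinitePlace.mk σ) (plucker X) := by
  unfold wedgeNorm placeNorm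
  simp only [← map_plucker, InfinitePlace.apply]

variable [NumberField K]

/-- Each infinite place comes from `mult` embeddings: one if real, two conjugate ones if complex. -/
theorem prod_embeddings_eq_prod_places (f : InfinitePlace K → ℝ) :
    ∏ σ : K →+* ℂ, f (InfinitePlace.mk σ) = ∏ v, f v ^ v.mult := by
  classical
  rw [← Finset.prod_fiberwise Finset.univ (fun σ : K →+* ℂ => InfinitePlace.mk σ)]
  refine Finset.prod_congr rfl fun v _ => ?_
  rw [Finset.prod_congr rfl fun σ hσ => by rw [(Finset.mem_filter.1 hσ).2], Finset.prod_const,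
    InfinitePlace.card_filter_mk_eq]

theorem familyHeight_eq_placeNorm (X : Fin d → Fin n → K) : familyHeight X =
    ((FractionalIdeal.absNorm (FractionalIdeal.spanFinset (𝓞 K) Finset.univ (plucker X)) : ℚ) :
      ℝ)⁻¹ * ∏ v, placeNorm v (plucker X) ^ v.mult := by
  rw [familyHeight, ← prod_embeddings_eq_prod_places]
  simp only [wedgeNorm_map_eq_placeNorm]

theorem absNorm_spanFinset_coe {ι : Type*} [Fintype ι] (p : ι → K) (m : ι → 𝓞 K)
    (hp : ∀ i, p i = m i) :
    FractionalIdeal.absNorm (FractionalIdeal.spanFinset (𝓞 K) Finset.univ p) =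
      Ideal.absNorm (Ideal.span (Set.range m)) := by
  have h : FractionalIdeal.spanFinset (𝓞 K) Finset.univ p =
      ((Ideal.span (Set.range m) : Ideal (𝓞 K)) : FractionalIdeal (nonZeroDivisors (𝓞 K)) K) := by
    apply FractionalIdeal.coeToSubmodule_injective
    simp only [FractionalIdeal.spanFinset_coe, FractionalIdeal.coe_coeIdeal]
    rw [IsLocalization.coeSubmodule_span]
    congr 1
    ext z
    simp [hp]
  rw [h, FractionalIdeal.coeIdeal_absNorm]

theorem absNorm_span_pos {ι : Type*} {m : ι → 𝓞 K} {i : ι} (hi : m i ≠ 0) :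
    0 < Ideal.absNorm (Ideal.span (Set.range m)) := by
  rw [Nat.pos_iff_ne_zero, Ne, Ideal.absNorm_eq_zero_iff, Ideal.span_eq_bot]
  exact fun h => hi (h _ ⟨i, rfl⟩)

theorem familyHeight_of_integral (X : Fin d → Fin n → K) (m : (Fin d ↪o Fin n) → 𝓞 K)
    (hm : ∀ I, plucker X I = m I) : familyHeight X =
      (Ideal.absNorm (Ideal.span (Set.range m)) : ℝ)⁻¹ * ∏ v, placeNorm v (plucker X) ^ v.mult := by
  rw [familyHeight_eq_placeNorm, absNorm_spanFinset_coe _ m hm]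
  simp

theorem prod_placeNorm_nonneg {ι : Type*} [Fintype ι] (p : ι → K) :
    0 ≤ ∏ v, placeNorm v p ^ v.mult :=
  Finset.prod_nonneg fun v _ => pow_nonneg (placeNorm_nonneg v p) _

theorem familyHeight_le_of_integral (X : Fin d → Fin n → K) (m : (Fin d ↪o Fin n) → 𝓞 K)
    (hm : ∀ I, plucker X I = m I) (hne : ∃ I, m I ≠ 0) :
    familyHeight X ≤ ∏ v, placeNorm v (plucker X) ^ v.mult := by
  obtain ⟨I, hI⟩ := hne
  rw [familyHeight_of_integral X m hm]
  refine mul_le_of_le_one_left (prod_placeNorm_nonneg _) (inv_le_one_of_one_le₀ ?_)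
  exact_mod_cast absNorm_span_pos hI

/-- A basis of `S` from an integral family with a non-zero maximal minor. -/
theorem subspaceHeight_eq_of_integralPoints (S : Submodule K (Fin n → K))
    (hS : Module.finrank K S = d) (X : Fin d → Fin n → 𝓞 K) (hXS : ∀ a, X a ∈ integralPoints S)
    (hX : ∃ I, plucker X I ≠ 0) :
    subspaceHeight S = familyHeight fun a => toField (X a) := by
  have hli := linearIndependent_toField_iff.2 hX
  have hli' : LinearIndependent K fun a => (⟨toField (X a), hXS a⟩ : S) :=
    LinearIndependent.of_comp S.subtype hli
  let b := Module.Basis.mk hli' (hli'.span_eq_top_of_card_eq_finrank' (by simp [hS])).ge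
  rw [subspaceHeight_eq S b]
  congr 1
  funext a
  simp [b]

/-- For an integral basis, a non-zero minor lies in the ideal of minors, so the norm of that ideal
is at most the absolute norm of the minor, which is the product of its absolute values over the
infinite places. -/
theorem one_le_subspaceHeight (S : Submodule K (Fin n → K)) : 1 ≤ subspaceHeight S := by
  obtain ⟨X, hXS, I, hI⟩ := exists_integral_family S rfl
  rw [subspaceHeight_eq_of_integralPoints S rfl X hXS ⟨I, hI⟩,
    familyHeight_of_integral _ _ (plucker_toField X), ← div_eq_inv_mul,
    one_le_div (by exact_mod_cast absNorm_span_pos hI)]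
  have h1 : Ideal.absNorm (Ideal.span (Set.range (plucker X))) ≤
      (Algebra.norm ℤ (plucker X I)).natAbs := by
    rw [← Ideal.absNorm_span_singleton]
    refine Nat.le_of_dvd ?_ (Ideal.absNorm_dvd_absNorm_of_le ?_)
    · rwa [Nat.pos_iff_ne_zero, Ne, Ideal.absNorm_eq_zero_iff, Ideal.span_singleton_eq_bot]
    · rw [Ideal.span_singleton_le_iff_mem]
      exact Ideal.subset_span ⟨I, rfl⟩
  have h2 : (((Algebra.norm ℤ (plucker X I)).natAbs : ℕ) : ℝ) =
      ∏ v : InfinitePlace K, v ((plucker X I : 𝓞 K) : K) ^ v.mult := by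
    rw [InfinitePlace.prod_eq_abs_norm, ← Algebra.coe_norm_int]
    simp
  refine (Nat.cast_le.2 h1).trans (h2.le.trans ?_)
  refine Finset.prod_le_prod (fun v _ => by positivity) fun v _ => ?_
  rw [← plucker_toField]
  exact pow_le_pow_left₀ (apply_nonneg v _) (le_placeNorm v _ I) _

theorem subspaceHeight_pos (S : Submodule K (Fin n → K)) : 0 < subspaceHeight S :=
  one_pos.trans_le (one_le_subspaceHeight S)

/-! ### Hyperplanes of a subspace -/

theorem finrank_inf_ker {F V : Type*} [Field F] [AddCommGroup V] [Module F V]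
    (S : Submodule F V) [FiniteDimensional F S] {k : ℕ}
    (hS : Module.finrank F S = k + 1) (l : V →ₗ[F] F) {w : V} (hw : w ∈ S) (hlw : l w ≠ 0) :
    Module.finrank F (S ⊓ LinearMap.ker l : Submodule F V) = k := by
  have h1 := (l.domRestrict S).finrank_range_add_finrank_ker
  have h2 : LinearMap.range (l.domRestrict S) = ⊤ := by
    rw [LinearMap.range_eq_top]
    refine LinearMap.surjective ?_
    intro h0
    exact hlw (LinearMap.congr_fun h0 ⟨w, hw⟩)
  have h3 : (S ⊓ LinearMap.ker l : Submodule F V) =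
      (LinearMap.ker (l.domRestrict S)).map S.subtype := by
    ext x
    simp [and_comm]
  rw [h3, Submodule.finrank_map_subtype_eq]
  rw [h2, finrank_top, Module.finrank_self, hS] at h1
  omega

/-- The hyperplane of `S` cut out by a functional has Grassmann coordinates the contraction. -/
theorem exists_plucker_eq_contraction {k : ℕ} (S : Submodule K (Fin n → K))
    (hS : Module.finrank K S = k + 1 + 1) (X : Fin (k + 1 + 1) → Fin n → K) (hXS : ∀ a, X a ∈ S)
    (hX : ∃ I, plucker X I ≠ 0) (l : (Fin n → K) →ₗ[K] K) (hl : ∃ a, l (X a) ≠ 0) :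
    ∃ Y : Fin (k + 1) → Fin n → K, (∀ J, plucker Y J = contraction (fun a => l (X a)) X J) ∧
      (∃ J, plucker Y J ≠ 0) ∧
      subspaceHeight (S ⊓ LinearMap.ker l : Submodule K (Fin n → K)) = familyHeight Y := by
  obtain ⟨a, ha⟩ := hl
  set S' : Submodule K (Fin n → K) := S ⊓ LinearMap.ker l with hS'
  have hrank : Module.finrank K S' = k + 1 := finrank_inf_ker S hS l (hXS a) ha
  let b := Module.finBasisOfFinrankEq K S' hrank
  let W : Fin (k + 1) → Fin n → K := fun i => ((b i : S') : Fin n → K)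
  have hWli : LinearIndependent K W := b.linearIndependent.map' S'.subtype S'.ker_subtype
  -- The vector w completes a basis W of the hyperplane to one of S. On it the functional is (1, 0,
  -- …, 0), so the contraction there is just the Grassmann coordinates of W.
  let w : Fin n → K := (l (X a))⁻¹ • X a
  have hlw : l w = 1 := by simp [w, ha]
  have hlW : ∀ i, l (W i) = 0 := fun i => (b i).2.2
  let W' : Fin (k + 1 + 1) → Fin n → K := Fin.cons w W
  have hW'li : LinearIndependent K W' := by
    refine linearIndependent_finCons.2 ⟨hWli, fun hw => ?_⟩
    have : Submodule.span K (Set.range W) ≤ LinearMap.ker l := by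
      rw [Submodule.span_le]
      rintro _ ⟨i, rfl⟩
      exact hlW i
    have h0 : l w = 0 := this hw
    rw [hlw] at h0
    exact one_ne_zero h0
  have hW'S : ∀ i, W' i ∈ S := by
    refine Fin.cases ?_ fun i => ?_
    · exact S.smul_mem _ (hXS a)
    · exact (b i).2.1
  have hspan : Submodule.span K (Set.range W') = S := by
    refine Submodule.eq_of_le_of_finrank_le ?_ ?_
    · rw [Submodule.span_le]
      rintro _ ⟨i, rfl⟩
      exact hW'S i
    · rw [finrank_span_eq_card hW'li, hS]
      simp
  have hU : ∀ a, ∃ c : Fin (k + 1 + 1) → K, ∑ i, c i • W' i = X a := fun a =>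
    (Submodule.mem_span_range_iff_exists_fun K).1 (hspan ▸ hXS a)
  choose U hU using hU
  have hXU : X = fun a j => ∑ c, U a c * W' c j := by
    funext a j
    rw [← hU a]
    simp
  have hlX : (fun a => l (X a)) =
      fun a => ∑ c, U a c * (Pi.single 0 1 : Fin (k + 1 + 1) → K) c := by
    funext a
    rw [← hU a, map_sum, Fin.sum_univ_succ]
    simp [W', hlw, hlW, Pi.single_apply]
  have hcontr : ∀ J, contraction (fun a => l (X a)) X J =
      (Matrix.of U).det * plucker W J := by
    intro J
    have h1 := contraction_mul (Matrix.of U) (Pi.single 0 1) W' J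
    rw [contraction_single, one_mul] at h1
    rw [hlX]
    conv_lhs => rw [hXU]
    exact h1
  have hdet : (Matrix.of U).det ≠ 0 := by
    obtain ⟨I, hI⟩ := hX
    have h1 := plucker_mul (Matrix.of U) W' I
    intro h0
    rw [h0, zero_mul] at h1
    apply hI
    rw [hXU]
    exact h1
  -- Scaling one vector of W by the determinant of the change of basis turns proportionality of the
  -- coordinates into equality, without affecting the height.
  let P : Matrix (Fin (k + 1)) (Fin (k + 1)) K :=
    Matrix.diagonal (Fin.cons (Matrix.of U).det fun _ => 1)
  have hP : P.det = (Matrix.of U).det := by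
    simp [P, Matrix.det_diagonal, Fin.prod_univ_succ]
  have hpl : ∀ J, plucker (fun a j => ∑ c, P a c * W c j) J =
      contraction (fun a => l (X a)) X J := fun J => by rw [plucker_mul, hP, hcontr]
  refine ⟨fun a j => ∑ c, P a c * W c j, hpl, ?_, ?_⟩
  · obtain ⟨J, hJ⟩ := exists_plucker_ne_zero hWli
    exact ⟨J, by rw [plucker_mul, hP]; exact mul_ne_zero hdet hJ⟩
  · rw [familyHeight_mul P (by rwa [hP]), subspaceHeight_eq S' b]

/-- The contraction coordinates are integral, so the ideal they generate has norm at least 1 and can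
be discarded from the height. -/
theorem subspaceHeight_inf_ker_le {k : ℕ} (S : Submodule K (Fin n → K))
    (hS : Module.finrank K S = k + 1 + 1) (X : Fin (k + 1 + 1) → Fin n → 𝓞 K)
    (hXS : ∀ a, X a ∈ integralPoints S) (hX : ∃ I, plucker X I ≠ 0)
    (φ : Fin (k + 1 + 1) → 𝓞 K) (hφ : φ ≠ 0) (l : (Fin n → K) →ₗ[K] K)
    (hl : ∀ a, l (toField (X a)) = φ a) :
    subspaceHeight (S ⊓ LinearMap.ker l : Submodule K (Fin n → K)) ≤
      ∏ v, placeNorm v (fun J => ((contraction φ X J : 𝓞 K) : K)) ^ v.mult := by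
  have hX' : ∃ I, plucker (fun a => toField (X a)) I ≠ 0 := by
    obtain ⟨I, hI⟩ := hX
    exact ⟨I, by rw [plucker_toField]; simpa using hI⟩
  obtain ⟨a, ha⟩ := Function.ne_iff.1 hφ
  obtain ⟨Y, hY, ⟨J, hJ⟩, hht⟩ := exists_plucker_eq_contraction S hS (fun a => toField (X a)) hXS
    hX' l ⟨a, by rw [hl]; simpa using ha⟩
  have hY' : ∀ J, plucker Y J = ((contraction φ X J : 𝓞 K) : K) := by
    intro J
    rw [hY]
    simp only [hl]
    exact (map_contraction (algebraMap (𝓞 K) K) φ X J).symm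
  rw [hht]
  refine (familyHeight_le_of_integral Y _ hY' ⟨J, fun h0 => hJ ?_⟩).trans_eq ?_
  · rw [hY', h0]
    simp
  · rw [funext hY']

end GoingDown
end

noncomputable section
namespace GoingDown

/-! ### Closeness of subspaces and orthogonal projections -/

variable {𝕜 : Type*} [RCLike 𝕜] {n : ℕ}

local notation "𝔼" => EuclideanSpace 𝕜 (Fin n)

theorem norm_le_of_coord_le (x : 𝔼) {b : ℝ} (hb : 0 ≤ b) (hx : ∀ i, ‖x i‖ ≤ b) :
    ‖x‖ ≤ (n + 1) * b := by
  rw [EuclideanSpace.norm_eq]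
  have := sqrt_sum_sq_le (fun i => ‖x i‖) hb fun i => by simpa using hx i
  simpa using this

theorem norm_minor_le_wedgeNorm (x y : 𝔼) (i j : Fin n) :
    ‖x i * y j - x j * y i‖ ≤ wedgeNorm ![WithLp.ofLp x, WithLp.ofLp y] := by
  have h := norm_det_select_le ![WithLp.ofLp x, WithLp.ofLp y] (wedgeNorm_nonneg _)
    (norm_plucker_le_wedgeNorm _) ![i, j]
  rw [Matrix.det_fin_two] at h
  simpa using h

/-- The scalar s is the coefficient of the orthogonal projection of x to the line of y. Each
coordinate of ‖y‖²(x - s y) is a combination of 2 × 2 minors with the conjugate coordinates of y as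
coefficients. -/
theorem exists_norm_sub_smul_le_wedgeNorm (x y : 𝔼) (hy : y ≠ 0) :
    ∃ s : 𝕜, ‖x - s • y‖ * ‖y‖ ≤
      (n + 1) * (n * wedgeNorm ![WithLp.ofLp x, WithLp.ofLp y]) := by
  set w := wedgeNorm ![WithLp.ofLp x, WithLp.ofLp y] with hw
  have hw0 : 0 ≤ w := wedgeNorm_nonneg _
  have hy0 : 0 < ‖y‖ := norm_pos_iff.2 hy
  have hyne : ((‖y‖ : ℝ) : 𝕜) ≠ 0 := by exact_mod_cast hy0.ne'
  have hsq : ∑ j, star (y j) * y j = ((‖y‖ : ℝ) : 𝕜) ^ 2 := by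
    rw [← RCLike.ofReal_pow, EuclideanSpace.norm_sq_eq, RCLike.ofReal_sum]
    refine Finset.sum_congr rfl fun j _ => ?_
    rw [RCLike.ofReal_pow]
    exact RCLike.conj_mul (y j)
  refine ⟨(∑ j, star (y j) * x j) * (((‖y‖ : ℝ) : 𝕜) ^ 2)⁻¹, ?_⟩
  set s := (∑ j, star (y j) * x j) * (((‖y‖ : ℝ) : 𝕜) ^ 2)⁻¹ with hs
  have hcoord : ∀ i, ‖(x - s • y) i‖ ≤ n * w / ‖y‖ := by
    intro i
    have h1 : (x - s • y) i * ((‖y‖ : ℝ) : 𝕜) ^ 2 =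
        ∑ j, star (y j) * (x i * y j - x j * y i) := by
      have h2 : s * ((‖y‖ : ℝ) : 𝕜) ^ 2 = ∑ j, star (y j) * x j := by
        rw [hs, mul_assoc, inv_mul_cancel₀ (pow_ne_zero _ hyne), mul_one]
      calc (x - s • y) i * ((‖y‖ : ℝ) : 𝕜) ^ 2
          = x i * ((‖y‖ : ℝ) : 𝕜) ^ 2 - (s * ((‖y‖ : ℝ) : 𝕜) ^ 2) * y i := by
            simp only [PiLp.sub_apply, PiLp.smul_apply, smul_eq_mul]
            ring
        _ = _ := by
            rw [h2, ← hsq, Finset.mul_sum, Finset.sum_mul, ← Finset.sum_sub_distrib]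
            refine Finset.sum_congr rfl fun j _ => ?_
            ring
    have h3 : ‖(x - s • y) i‖ * ‖y‖ ^ 2 ≤ n * (‖y‖ * w) := by
      calc ‖(x - s • y) i‖ * ‖y‖ ^ 2 = ‖(x - s • y) i * ((‖y‖ : ℝ) : 𝕜) ^ 2‖ := by
            rw [norm_mul, norm_pow, RCLike.norm_ofReal, abs_norm]
        _ ≤ ∑ j, ‖star (y j) * (x i * y j - x j * y i)‖ := by
            rw [h1]
            exact norm_sum_le _ _
        _ ≤ ∑ _j : Fin n, ‖y‖ * w := by
            refine Finset.sum_le_sum fun j _ => ?_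
            rw [norm_mul, norm_star]
            exact mul_le_mul (PiLp.norm_apply_le y j) (norm_minor_le_wedgeNorm x y i j)
              (norm_nonneg _) (norm_nonneg _)
        _ = n * (‖y‖ * w) := by simp
    rw [le_div_iff₀ hy0]
    refine le_of_mul_le_mul_right ?_ hy0
    calc ‖(x - s • y) i‖ * ‖y‖ * ‖y‖ = ‖(x - s • y) i‖ * ‖y‖ ^ 2 := by ring
      _ ≤ n * (‖y‖ * w) := h3
      _ = n * w * ‖y‖ := by ring
  calc ‖x - s • y‖ * ‖y‖ ≤ ((n + 1) * (n * w / ‖y‖)) * ‖y‖ := by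
        gcongr
        exact norm_le_of_coord_le _ (by positivity) hcoord
    _ = (n + 1) * (n * w) := by field_simp

/-- Subtracting a multiple of y from x changes no 2 × 2 minor. -/
theorem wedgeNorm_le_norm_sub_smul (x y : 𝔼) (s : 𝕜) :
    wedgeNorm ![WithLp.ofLp x, WithLp.ofLp y] ≤
      (Fintype.card (Fin 2 ↪o Fin n) + 1) * (2 * (‖x - s • y‖ * ‖y‖)) := by
  refine wedgeNorm_le _ (by positivity) fun I => ?_
  have h : plucker ![WithLp.ofLp x, WithLp.ofLp y] I =
      (x - s • y) (I 0) * y (I 1) - (x - s • y) (I 1) * y (I 0) := by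
    rw [plucker, Matrix.det_fin_two]
    simp
    ring
  rw [h]
  refine (norm_sub_le _ _).trans ?_
  rw [norm_mul, norm_mul, two_mul]
  exact add_le_add
    (mul_le_mul (PiLp.norm_apply_le _ _) (PiLp.norm_apply_le _ _) (norm_nonneg _) (norm_nonneg _))
    (mul_le_mul (PiLp.norm_apply_le _ _) (PiLp.norm_apply_le _ _) (norm_nonneg _) (norm_nonneg _))

theorem projDist_nonneg (x y : 𝔼) : 0 ≤ projDist x y :=
  div_nonneg (wedgeNorm_nonneg _) (by positivity)

theorem distTo_nonneg (x : 𝔼) (B : Submodule 𝕜 𝔼) : 0 ≤ distTo x B :=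
  Real.iInf_nonneg fun _ => projDist_nonneg _ _

theorem nonempty_nonzero {B : Submodule 𝕜 𝔼} (hB : B ≠ ⊥) : Nonempty {y : 𝔼 // y ∈ B ∧ y ≠ 0} := by
  obtain ⟨y, hy, hy0⟩ := B.ne_bot_iff.1 hB
  exact ⟨⟨y, hy, hy0⟩⟩

theorem omega_nonneg (i : ℕ) (A B : Submodule 𝕜 𝔼) : 0 ≤ omega i A B :=
  Real.iInf_nonneg fun _ => Real.iSup_nonneg fun _ => distTo_nonneg _ _

/-- A constant comparing projective distances with Euclidean ones. -/
def distConst (n : ℕ) : ℝ := 2 * (n + 1) ^ 2 * (Fintype.card (Fin 2 ↪o Fin n) + 1)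

theorem distConst_pos (n : ℕ) : 0 < distConst n := by unfold distConst; positivity

/-- With `distTo_le` this lets ω(x, B) be replaced, up to `distConst`, by the relative distance from
x to its orthogonal projection; all later geometry is Hilbert space geometry. -/
theorem norm_sub_starProjection_le (x : 𝔼) {B : Submodule 𝕜 𝔼} (hB : B ≠ ⊥) (hx : x ≠ 0) :
    ‖x - B.starProjection x‖ ≤ distConst n * distTo x B * ‖x‖ := by
  have hx0 : 0 < ‖x‖ := norm_pos_iff.2 hx
  have := nonempty_nonzero hB
  have h : ‖x - B.starProjection x‖ / (distConst n * ‖x‖) ≤ distTo x B := by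
    refine le_ciInf fun ⟨y, hy, hy0⟩ => ?_
    have hy1 : 0 < ‖y‖ := norm_pos_iff.2 hy0
    obtain ⟨s, hs⟩ := exists_norm_sub_smul_le_wedgeNorm x y hy0
    have h1 : ‖x - B.starProjection x‖ ≤ ‖x - s • y‖ := by
      rw [Submodule.starProjection_minimal]
      exact ciInf_le ⟨0, by rintro _ ⟨z, rfl⟩; exact norm_nonneg _⟩ (⟨s • y, B.smul_mem s hy⟩ : B)
    set w := wedgeNorm ![WithLp.ofLp x, WithLp.ofLp y] with hw
    have hw0 : 0 ≤ w := wedgeNorm_nonneg _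
    have hc : ((n : ℝ) + 1) * n ≤ distConst n := by
      unfold distConst
      have : (0 : ℝ) ≤ Fintype.card (Fin 2 ↪o Fin n) := by positivity
      have hn : (0 : ℝ) ≤ n := by positivity
      nlinarith [mul_nonneg (sq_nonneg ((n : ℝ) + 1)) this]
    unfold projDist
    rw [div_le_div_iff₀ (mul_pos (distConst_pos n) hx0) (by positivity), ← hw]
    calc ‖x - B.starProjection x‖ * (‖x‖ * ‖y‖) ≤ (‖x - s • y‖ * ‖y‖) * ‖x‖ := by
          rw [mul_assoc, mul_comm ‖x‖]
          gcongr
      _ ≤ ((n + 1) * (n * w)) * ‖x‖ := by gcongr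
      _ = (((n : ℝ) + 1) * n) * w * ‖x‖ := by ring
      _ ≤ distConst n * w * ‖x‖ := by gcongr
      _ = w * (distConst n * ‖x‖) := by ring
  rw [div_le_iff₀ (mul_pos (distConst_pos n) hx0)] at h
  linarith

theorem distTo_le (x : 𝔼) {B : Submodule 𝕜 𝔼} (hB : B ≠ ⊥) (hx : x ≠ 0) {w : 𝔼} (hw : w ∈ B) :
    distTo x B ≤ distConst n * ‖x - w‖ / ‖x‖ := by
  have hx0 : 0 < ‖x‖ := norm_pos_iff.2 hx
  obtain ⟨y, hy, hy0, s, rfl⟩ : ∃ y ∈ B, y ≠ 0 ∧ ∃ s : 𝕜, w = s • y := by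
    by_cases hw0 : w = 0
    · obtain ⟨y, hy, hy0⟩ := B.ne_bot_iff.1 hB
      exact ⟨y, hy, hy0, 0, by simp [hw0]⟩
    · exact ⟨w, hw, hw0, 1, by simp⟩
  have hy1 : 0 < ‖y‖ := norm_pos_iff.2 hy0
  refine (ciInf_le ⟨0, by rintro _ ⟨z, rfl⟩; exact projDist_nonneg _ _⟩
    (⟨y, hy, hy0⟩ : {y : 𝔼 // y ∈ B ∧ y ≠ 0})).trans ?_
  unfold projDist
  rw [div_le_div_iff₀ (by positivity) hx0]
  have h := wedgeNorm_le_norm_sub_smul x y s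
  have hc : ((Fintype.card (Fin 2 ↪o Fin n) : ℝ) + 1) * 2 ≤ distConst n := by
    unfold distConst
    have : (0 : ℝ) ≤ Fintype.card (Fin 2 ↪o Fin n) := by positivity
    have hn : (1 : ℝ) ≤ (n + 1) ^ 2 := one_le_pow₀ (by linarith [n.cast_nonneg (α := ℝ)])
    nlinarith
  calc wedgeNorm ![WithLp.ofLp x, WithLp.ofLp y] * ‖x‖
      ≤ ((Fintype.card (Fin 2 ↪o Fin n) + 1) * (2 * (‖x - s • y‖ * ‖y‖))) * ‖x‖ := by gcongr
    _ = (((Fintype.card (Fin 2 ↪o Fin n) : ℝ) + 1) * 2) * (‖x - s • y‖ * ‖y‖ * ‖x‖) := by ring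
    _ ≤ distConst n * (‖x - s • y‖ * ‖y‖ * ‖x‖) := by gcongr
    _ = distConst n * ‖x - s • y‖ * (‖x‖ * ‖y‖) := by ring

theorem distTo_le_distConst (x : 𝔼) {B : Submodule 𝕜 𝔼} (hB : B ≠ ⊥) (hx : x ≠ 0) :
    distTo x B ≤ distConst n := by
  have hx0 : 0 < ‖x‖ := norm_pos_iff.2 hx
  have := distTo_le x hB hx B.zero_mem
  rwa [sub_zero, mul_div_cancel_right₀ _ hx0.ne'] at this

theorem omega_le {i : ℕ} {A B F : Submodule 𝕜 𝔼} (hB : B ≠ ⊥) (hFA : F ≤ A)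
    (hF : Module.finrank 𝕜 F = i) {ε : ℝ} (hε : 0 ≤ ε)
    (h : ∀ x ∈ F, ∃ w ∈ B, ‖x - w‖ ≤ ε * ‖x‖) : omega i A B ≤ distConst n * ε := by
  have hc := distConst_pos n
  refine (ciInf_le ⟨0, ?_⟩
    (⟨F, hFA, hF⟩ : {F : Submodule 𝕜 𝔼 // F ≤ A ∧ Module.finrank 𝕜 F = i})).trans ?_
  · rintro _ ⟨z, rfl⟩
    exact Real.iSup_nonneg fun _ => distTo_nonneg _ _
  · refine Real.iSup_le (fun ⟨x, hx, hx0⟩ => ?_) (by positivity)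
    obtain ⟨w, hw, hxw⟩ := h x hx
    refine (distTo_le x hB hx0 hw).trans ?_
    rw [div_le_iff₀ (norm_pos_iff.2 hx0), mul_assoc]
    gcongr

theorem exists_submodule_finrank_eq {F V : Type*} [Field F] [AddCommGroup V] [Module F V]
    [FiniteDimensional F V] {i : ℕ} (hi : i ≤ Module.finrank F V) :
    ∃ S : Submodule F V, Module.finrank F S = i := by
  have hli := (Module.finBasis F V).linearIndependent.comp (Fin.castLE hi)
    (Fin.castLE_injective hi)
  exact ⟨Submodule.span F (Set.range _), by rw [finrank_span_eq_card hli, Fintype.card_fin]⟩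

theorem le_omega {i : ℕ} {A B : Submodule 𝕜 𝔼} (hB : B ≠ ⊥) (hi : i ≤ Module.finrank 𝕜 A) {ε : ℝ}
    (h : ∀ F ≤ A, Module.finrank 𝕜 F = i →
      ∃ x ∈ F, x ≠ 0 ∧ ε * ‖x‖ ≤ ‖x - B.starProjection x‖) :
    ε ≤ distConst n * omega i A B := by
  have hc := distConst_pos n
  -- This is where i ≤ dim A matters: over an empty index type the real infimum defining `omega`
  -- would take the default value 0.
  have hne : Nonempty {F : Submodule 𝕜 𝔼 // F ≤ A ∧ Module.finrank 𝕜 F = i} := by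
    obtain ⟨F, hF⟩ := exists_submodule_finrank_eq (V := A) hi
    exact ⟨⟨F.map A.subtype, A.map_subtype_le F, by rw [Submodule.finrank_map_subtype_eq, hF]⟩⟩
  rw [← div_le_iff₀' hc]
  refine le_ciInf fun ⟨F, hFA, hF⟩ => ?_
  obtain ⟨x, hx, hx0, hle⟩ := h F hFA hF
  have hx1 : 0 < ‖x‖ := norm_pos_iff.2 hx0
  have h1 : ε / distConst n ≤ distTo x B := by
    rw [div_le_iff₀' hc]
    exact le_of_mul_le_mul_right (hle.trans (norm_sub_starProjection_le x hB hx0)) hx1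
  refine h1.trans (le_ciSup (f := fun x : {x : 𝔼 // x ∈ F ∧ x ≠ 0} => distTo x.1 B)
    ⟨distConst n, ?_⟩ ⟨x, hx, hx0⟩)
  rintro _ ⟨⟨z, hz, hz0⟩, rfl⟩
  exact distTo_le_distConst z hB hz0

/-- Principal directions of `A` with respect to `B`. -/
theorem exists_principal_basis (A B : Submodule 𝕜 𝔼) {d : ℕ} (hd : Module.finrank 𝕜 A = d) :
    ∃ (b : OrthonormalBasis (Fin d) 𝕜 A) (lam : Fin d → ℝ), Monotone lam ∧
      ∀ x : A, ‖(x : 𝔼) - B.starProjection x‖ ^ 2 = ∑ j, lam j * ‖inner 𝕜 (b j) x‖ ^ 2 := by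
  -- The compression to A of the projection to B is symmetric with ⟨Tx, x⟩ = ‖P_B x‖². In an
  -- eigenbasis ‖x - P_B x‖² is thus diagonal with entries 1 - eigenvalue, increasing because the
  -- eigenvalues are listed in decreasing order.
  let T : A →ₗ[𝕜] A := (A.orthogonalProjectionOnto ∘L B.starProjection ∘L A.subtypeL).toLinearMap
  have hTinner : ∀ x y : A, inner 𝕜 (T x) y = inner 𝕜 (B.starProjection (x : 𝔼)) (y : 𝔼) := by
    intro x y
    exact A.inner_orthogonalProjectionOnto_eq_of_mem_right y (B.starProjection (x : 𝔼))
  have hT : LinearMap.IsSymmetric (𝕜 := 𝕜) (E := A) T := by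
    intro x y
    rw [hTinner, ← inner_conj_symm x, hTinner, inner_conj_symm]
    exact B.inner_starProjection_left_eq_right _ _
  refine ⟨hT.eigenvectorBasis hd, fun j => 1 - hT.eigenvalues hd j, fun i j hij => ?_, fun x => ?_⟩
  · have := hT.eigenvalues_antitone hd hij
    simp only
    linarith
  · set b := hT.eigenvectorBasis hd
    have h1 : ‖(x : 𝔼)‖ ^ 2 = ∑ j, ‖inner 𝕜 (b j) x‖ ^ 2 := (b.sum_sq_norm_inner_right x).symm
    have h2 : ‖(x : 𝔼)‖ ^ 2 =
        ‖B.starProjection (x : 𝔼)‖ ^ 2 + ‖(x : 𝔼) - B.starProjection x‖ ^ 2 := by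
      have h := norm_add_sq_eq_norm_sq_add_norm_sq_of_inner_eq_zero
        (B.starProjection (x : 𝔼)) ((x : 𝔼) - B.starProjection x)
        (B.sub_starProjection_mem_orthogonal (x : 𝔼) _ (B.starProjection_apply_mem _))
      rw [add_sub_cancel] at h
      linarith
    have h3 : ‖B.starProjection (x : 𝔼)‖ ^ 2 =
        ∑ j, hT.eigenvalues hd j * ‖inner 𝕜 (b j) x‖ ^ 2 := by
      have h4 : inner 𝕜 (T x) x = ((‖B.starProjection (x : 𝔼)‖ ^ 2 : ℝ) : 𝕜) := by
        rw [hTinner, RCLike.ofReal_pow, ← inner_self_eq_norm_sq_to_K,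
          ← B.inner_starProjection_left_eq_right,
          B.starProjection_eq_self_iff.2 (B.starProjection_apply_mem _)]
      have h5 : inner 𝕜 (T x) x =
          ((∑ j, hT.eigenvalues hd j * ‖inner 𝕜 (b j) x‖ ^ 2 : ℝ) : 𝕜) := by
        rw [← b.sum_inner_mul_inner, RCLike.ofReal_sum]
        refine Finset.sum_congr rfl fun j _ => ?_
        rw [hT, hT.apply_eigenvectorBasis hd j, inner_smul_right, mul_assoc,
          ← inner_conj_symm x (b j), RCLike.conj_mul]
        push_cast
        rfl
      exact_mod_cast h4.symm.trans h5
    simp only [sub_mul, one_mul, Finset.sum_sub_distrib]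
    linarith

/-- Orthonormal vectors of `A` realizing all the closeness invariants up to a constant. -/
theorem exists_orthonormal_close (A B : Submodule 𝕜 𝔼) (hB : B ≠ ⊥) {d : ℕ}
    (hd : Module.finrank 𝕜 A = d) :
    ∃ x : Fin d → 𝔼, Orthonormal 𝕜 x ∧ (∀ j, x j ∈ A) ∧
      ∀ (i : Fin d) (t : Fin d → 𝕜), (∀ j, i < j → t j = 0) →
        ‖(∑ j, t j • x j) - B.starProjection (∑ j, t j • x j)‖ ≤
          distConst n * omega (i + 1) A B * ‖∑ j, t j • x j‖ := by
  obtain ⟨b, lam, hmono, hb⟩ := exists_principal_basis A B hd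
  have hlam : ∀ i, 0 ≤ lam i := by
    intro i
    have h := hb (b i)
    rw [Finset.sum_eq_single i] at h
    · have : ‖inner 𝕜 (b i) (b i)‖ = 1 := by simp
      rw [this] at h
      have h' := sq_nonneg ‖((b i : A) : 𝔼) - B.starProjection (b i : A)‖
      rw [h] at h'
      simpa using h'
    · intro j _ hj
      rw [b.orthonormal.2 hj]
      simp
    · simp
  -- Courant–Fischer: a subspace of dimension i + 1 contains a non-zero vector orthogonal to the
  -- first i principal directions, and there the form is at least lam i. Indices start at 0, hence
  -- `omega (i + 1)`.
  have homega : ∀ i : Fin d, √(lam i) ≤ distConst n * omega (i + 1) A B := by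
    intro i
    refine le_omega hB (by omega) fun F hFA hF => ?_
    let f : F →ₗ[𝕜] (Fin i → 𝕜) :=
      LinearMap.pi fun j => (innerₛₗ 𝕜 (b ⟨j, j.2.trans i.2⟩)) ∘ₗ Submodule.inclusion hFA
    have hker : LinearMap.ker f ≠ ⊥ := by
      refine LinearMap.ker_ne_bot_of_finrank_lt ?_
      rw [hF]
      simp
    obtain ⟨⟨x, hx⟩, hxf, hx0⟩ := (LinearMap.ker f).ne_bot_iff.1 hker
    have hx0' : x ≠ 0 := fun h => hx0 (by ext1; exact h)
    refine ⟨x, hx, hx0', ?_⟩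
    have hzero : ∀ j : Fin d, j < i → inner 𝕜 (b j) (⟨x, hFA hx⟩ : A) = 0 := fun j hj =>
      congrFun hxf ⟨j, hj⟩
    refine abs_le_of_sq_le_sq' ?_ (norm_nonneg _) |>.2
    rw [mul_pow, Real.sq_sqrt (hlam i), hb ⟨x, hFA hx⟩]
    have h1 : ‖x‖ ^ 2 = ∑ j, ‖inner 𝕜 (b j) (⟨x, hFA hx⟩ : A)‖ ^ 2 :=
      (b.sum_sq_norm_inner_right (⟨x, hFA hx⟩ : A)).symm
    rw [h1, Finset.mul_sum]
    refine Finset.sum_le_sum fun j _ => ?_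
    rcases lt_or_ge j i with hj | hj
    · rw [hzero j hj]
      simp
    · gcongr
      exact hmono hj
  refine ⟨fun j => (b j : A), ?_, fun j => (b j).2, fun i t ht => ?_⟩
  · exact b.orthonormal.comp_linearIsometry A.subtypeₗᵢ
  · set u : A := ∑ j, t j • b j with hu
    have hu' : ∑ j, t j • ((b j : A) : 𝔼) = u := by simp [hu]
    have hinner : ∀ j, inner 𝕜 (b j) u = t j := fun j => b.orthonormal.inner_right_fintype t j
    rw [hu']
    have h1 : ‖(u : 𝔼) - B.starProjection u‖ ^ 2 ≤ lam i * ‖(u : 𝔼)‖ ^ 2 := by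
      have h2 : ‖(u : 𝔼)‖ ^ 2 = ∑ j, ‖inner 𝕜 (b j) u‖ ^ 2 := (b.sum_sq_norm_inner_right u).symm
      rw [hb, h2, Finset.mul_sum]
      refine Finset.sum_le_sum fun j _ => ?_
      rcases lt_or_ge i j with hj | hj
      · rw [hinner, ht j hj]
        simp
      · gcongr
        exact hmono hj
    calc ‖(u : 𝔼) - B.starProjection u‖ ≤ √(lam i) * ‖(u : 𝔼)‖ := by
          refine abs_le_of_sq_le_sq' ?_ (by positivity) |>.2
          rw [mul_pow, Real.sq_sqrt (hlam i)]
          exact h1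
      _ ≤ _ := by
          gcongr
          exact homega i

end GoingDown
end

noncomputable section
namespace GoingDown

/-! ### Bounded systems of linear forms -/

open NumberField

section Forms

variable {L : Type*} [NormedField L] {k n : ℕ}

theorem eq_mul_inv_mul {d : ℕ} {U : Matrix (Fin d) (Fin d) L} (hU : U.det ≠ 0) (φ : Fin d → L)
    (a : Fin d) : ∑ c, U a c * ∑ b, U⁻¹ c b * φ b = φ a := by
  have h : U.mulVec (U⁻¹.mulVec φ) = φ := by
    rw [Matrix.mulVec_mulVec, Matrix.mul_nonsing_inv _ (isUnit_iff_ne_zero.2 hU),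
      Matrix.one_mulVec]
  exact congrFun h a

/-- The family x is U times a family with entries bounded by 1, so its minors are at most about |det
U|. -/
theorem norm_plucker_le_of_forms {d : ℕ} (x : Fin d → Fin n → L) {U : Matrix (Fin d) (Fin d) L}
    (hU : U.det ≠ 0) (hZ : ∀ a j, ‖∑ c, U⁻¹ a c * x c j‖ ≤ 1) (I : Fin d ↪o Fin n) :
    ‖plucker x I‖ ≤ ‖U.det‖ * d.factorial := by
  have h := plucker_mul U (fun a j => ∑ c, U⁻¹ a c * x c j) I
  have hx : (fun a j => ∑ c, U a c * ∑ b, U⁻¹ c b * x b j) = x := by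
    funext a j
    exact eq_mul_inv_mul hU (fun b => x b j) a
  rw [hx] at h
  rw [h, norm_mul]
  gcongr
  exact norm_plucker_le_factorial _ hZ I

theorem norm_contraction_le_of_forms (x : Fin (k + 1) → Fin n → L)
    {U : Matrix (Fin (k + 1)) (Fin (k + 1)) L} (hU : U.det ≠ 0)
    (hZ : ∀ a j, ‖∑ c, U⁻¹ a c * x c j‖ ≤ 1) (φ : Fin (k + 1) → L) {N : ℝ}
    (hN : ∀ a, ‖∑ c, U⁻¹ a c * φ c‖ ≤ N) (J : Fin k ↪o Fin n) :
    ‖contraction φ x J‖ ≤ ‖U.det‖ * ((k + 1).factorial * N) := by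
  have h := contraction_mul U (fun a => ∑ c, U⁻¹ a c * φ c) (fun a j => ∑ c, U⁻¹ a c * x c j) J
  have hx : (fun a j => ∑ c, U a c * ∑ b, U⁻¹ c b * x b j) = x := by
    funext a j
    exact eq_mul_inv_mul hU (fun b => x b j) a
  have hφ : (fun a => ∑ c, U a c * ∑ b, U⁻¹ c b * φ b) = φ := by
    funext a
    exact eq_mul_inv_mul hU φ a
  rw [hx, hφ] at h
  rw [h, norm_mul]
  gcongr
  exact norm_contraction_le _ _ hZ hN J

end Forms

variable {K : Type*} [Field K] {k n : ℕ}

theorem map_plucker_coe {L : Type*} [CommRing L] (g : K →+* L) {d : ℕ} (X : Fin d → Fin n → 𝓞 K)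
    (I : Fin d ↪o Fin n) :
    g ((plucker X I : 𝓞 K) : K) = plucker (fun a j => g (X a j)) I :=
  map_plucker (g.comp (algebraMap (𝓞 K) K)) X I

theorem map_contraction_coe {L : Type*} [CommRing L] (g : K →+* L) (φ : Fin (k + 1) → 𝓞 K)
    (X : Fin (k + 1) → Fin n → 𝓞 K) (J : Fin k ↪o Fin n) :
    g ((contraction φ X J : 𝓞 K) : K) =
      contraction (fun a => g (φ a)) (fun a j => g (X a j)) J :=
  map_contraction (g.comp (algebraMap (𝓞 K) K)) φ X J

/-- The Euclidean norm at a place of the Grassmann coordinates of an integral family. -/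
def placeWedge {d : ℕ} (v : InfinitePlace K) (X : Fin d → Fin n → 𝓞 K) : ℝ :=
  placeNorm v fun I => ((plucker X I : 𝓞 K) : K)

theorem placeWedge_nonneg {d : ℕ} (v : InfinitePlace K) (X : Fin d → Fin n → 𝓞 K) :
    0 ≤ placeWedge v X := placeNorm_nonneg _ _

/-- A constant for the comparison of linear forms with Grassmann coordinates. -/
def formConst (k n : ℕ) : ℝ :=
  (Fintype.card (Fin (k + 1) ↪o Fin n) + 1) * (Fintype.card (Fin k ↪o Fin n) + 1) *
    (k + 1).factorial * (n + 1) ^ (k + 1)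

/-- The linear forms with matrix `M` at the place `v` are adapted to the family `X`. -/
structure Adapted (v : InfinitePlace K) (X : Fin (k + 1) → Fin n → 𝓞 K)
    (M : Matrix (Fin (k + 1)) (Fin (k + 1)) ℂ) : Prop where
  im_eq_zero : v.IsReal → ∀ i j, (M i j).im = 0
  det_ne_zero : M.det ≠ 0
  wedge_le : placeWedge v X ≤ formConst k n * ‖M.det‖⁻¹
  contraction_le : ∀ (φ : Fin (k + 1) → 𝓞 K) (N : ℝ), 0 ≤ N →
    (∀ j, ‖∑ a, M j a * v.embedding (φ a)‖ ≤ N) →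
      placeNorm v (fun J => ((contraction φ X J : 𝓞 K) : K)) ≤
        formConst k n * placeWedge v X * N

theorem one_le_formConst (k n : ℕ) : 1 ≤ formConst k n := by
  unfold formConst
  have h3 : (1 : ℝ) ≤ (k + 1).factorial := by exact_mod_cast Nat.factorial_pos _
  have h4 : (1 : ℝ) ≤ (n + 1 : ℝ) ^ (k + 1) := one_le_pow₀ (by linarith [n.cast_nonneg (α := ℝ)])
  refine one_le_mul_of_one_le_of_one_le (one_le_mul_of_one_le_of_one_le
    (one_le_mul_of_one_le_of_one_le ?_ ?_) h3) h4 <;> simp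

/-- The forms are naturally given by U⁻¹ over a field L in which v is the absolute value, and M is
their copy over ℂ. It is used with L = ℂ and U a largest minor, and with L = 𝕜 and U the coordinates
in an orthonormal basis. -/
theorem adapted_of_bounds (v : InfinitePlace K) (X : Fin (k + 1) → Fin n → 𝓞 K)
    (M : Matrix (Fin (k + 1)) (Fin (k + 1)) ℂ) (him : v.IsReal → ∀ i j, (M i j).im = 0)
    {L : Type*} [NormedField L] (ι : K →+* L) (hι : ∀ x, v x = ‖ι x‖)
    (U : Matrix (Fin (k + 1)) (Fin (k + 1)) L) (hU : U.det ≠ 0)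
    (hMU : ‖M.det‖ = ‖U⁻¹.det‖)
    (hforms : ∀ (φ : Fin (k + 1) → K) j,
      ‖∑ a, M j a * v.embedding (φ a)‖ = ‖∑ a, U⁻¹ j a * ι (φ a)‖)
    (hZ : ∀ a j, ‖∑ c, U⁻¹ a c * ι (X c j)‖ ≤ 1)
    (hdet : ‖U.det‖ ≤ (n + 1) ^ (k + 1) * placeWedge v X) : Adapted v X M := by
  have hdetM : ‖M.det‖⁻¹ = ‖U.det‖ := by
    rw [hMU, Matrix.det_nonsing_inv, Ring.inverse_eq_inv', norm_inv, inv_inv]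
  have hU0 : 0 < ‖U.det‖ := norm_pos_iff.2 hU
  have c1 : (0 : ℝ) ≤ Fintype.card (Fin (k + 1) ↪o Fin n) := by positivity
  have c2 : (0 : ℝ) ≤ Fintype.card (Fin k ↪o Fin n) := by positivity
  have c3 : (1 : ℝ) ≤ (n + 1 : ℝ) ^ (k + 1) := one_le_pow₀ (by linarith [n.cast_nonneg (α := ℝ)])
  refine ⟨him, ?_, ?_, fun φ N hN0 hN => ?_⟩
  · rw [← norm_pos_iff, ← inv_pos, hdetM]
    exact hU0
  · rw [hdetM]
    calc placeWedge v X ≤ (Fintype.card (Fin (k + 1) ↪o Fin n) + 1) *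
          (‖U.det‖ * (k + 1).factorial) := by
          refine placeNorm_le _ _ (by positivity) fun I => ?_
          rw [hι, map_plucker_coe]
          exact norm_plucker_le_of_forms _ hU hZ I
      _ = ((Fintype.card (Fin (k + 1) ↪o Fin n) + 1) * 1 * (k + 1).factorial * 1) *
            ‖U.det‖ := by ring
      _ ≤ formConst k n * ‖U.det‖ := by
          unfold formConst
          gcongr
          linarith
  · calc placeNorm v (fun J => ((contraction φ X J : 𝓞 K) : K))
        ≤ (Fintype.card (Fin k ↪o Fin n) + 1) * (‖U.det‖ * ((k + 1).factorial * N)) := by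
          refine placeNorm_le _ _ (by positivity) fun J => ?_
          rw [hι, map_contraction_coe]
          refine norm_contraction_le_of_forms _ hU hZ _ (fun j => ?_) J
          exact (hforms (fun a => (φ a : K)) j).symm.trans_le (hN j)
      _ ≤ (Fintype.card (Fin k ↪o Fin n) + 1) *
            (((n + 1) ^ (k + 1) * placeWedge v X) * ((k + 1).factorial * N)) := by gcongr
      _ = (1 * (Fintype.card (Fin k ↪o Fin n) + 1) * (k + 1).factorial * (n + 1) ^ (k + 1)) *
            placeWedge v X * N := by ring
      _ ≤ formConst k n * placeWedge v X * N := by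
          have := placeWedge_nonneg v X
          unfold formConst
          gcongr
          linarith

/-- Every place has linear forms adapted to a given independent integral family. -/
theorem exists_adapted (v : InfinitePlace K) (X : Fin (k + 1) → Fin n → 𝓞 K)
    (hX : ∃ I, plucker X I ≠ 0) : ∃ M, Adapted v X M := by
  classical
  let x : Fin (k + 1) → Fin n → ℂ := fun a j => v.embedding (X a j)
  have hx : ∀ I, plucker x I = v.embedding (plucker X I : 𝓞 K) := fun I =>
    (map_plucker_coe v.embedding X I).symm
  obtain ⟨I₀, hI₀⟩ := hX
  -- The columns of a largest minor serve as U: by Cramer's rule all columns then have coordinates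
  -- bounded by 1.
  obtain ⟨I, -, hI⟩ := Finset.exists_max_image Finset.univ (fun I => ‖plucker x I‖)
    ⟨I₀, Finset.mem_univ _⟩
  have hI0 : plucker x I ≠ 0 := by
    rw [← norm_pos_iff]
    refine lt_of_lt_of_le ?_ (hI I₀ (Finset.mem_univ _))
    rw [norm_pos_iff, hx]
    simpa using hI₀
  let U : Matrix (Fin (k + 1)) (Fin (k + 1)) ℂ := Matrix.of fun a b => x a (I b)
  have hUdet : U.det = plucker x I := rfl
  refine ⟨U⁻¹, adapted_of_bounds v X _ (fun hv => ?_) v.embedding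
    (fun y => (InfinitePlace.norm_embedding_eq v y).symm) U hI0 rfl (fun _ _ => rfl)
    (fun a j => norm_inv_mul_le_one x I hI0 (fun J => hI J (Finset.mem_univ _)) a j) ?_⟩
  · let V : Matrix (Fin (k + 1)) (Fin (k + 1)) ℝ :=
      Matrix.of fun a b => InfinitePlace.embedding_of_isReal hv (X a (I b))
    have hUV : U = V.map Complex.ofRealHom := by
      ext a b
      simp [U, V, x, InfinitePlace.embedding_of_isReal_apply]
    have hinv : U⁻¹ = (V⁻¹).map Complex.ofRealHom := by
      refine Matrix.inv_eq_left_inv ?_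
      have hV : IsUnit V.det := by
        rw [isUnit_iff_ne_zero]
        intro h0
        apply hI0
        rw [← hUdet, hUV]
        exact (RingHom.map_det Complex.ofRealHom V).symm.trans (by rw [h0, map_zero])
      rw [hUV, ← Matrix.map_mul, Matrix.nonsing_inv_mul _ hV]
      simp
    intro i j
    rw [hinv]
    simp
  · rw [hUdet, hx, InfinitePlace.norm_embedding_eq]
    have h1 := le_placeNorm v (fun I => ((plucker X I : 𝓞 K) : K)) I
    have c3 : (1 : ℝ) ≤ (n + 1 : ℝ) ^ (k + 1) := one_le_pow₀ (by linarith [n.cast_nonneg (α := ℝ)])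
    exact h1.trans (le_mul_of_one_le_left (placeWedge_nonneg v X) c3)

/-! ### The distinguished place -/

section Transfer

variable {𝕜 : Type*} [RCLike 𝕜]

theorem exists_ringHom_complex_of_finrank_eq_one (h : Module.finrank ℝ 𝕜 = 1) :
    ∃ τ : 𝕜 →+* ℂ, (∀ z, ‖τ z‖ = ‖z‖) ∧ ∀ z, (τ z).im = 0 := by
  have hI : (RCLike.I : 𝕜) = 0 := by
    rcases RCLike.I_eq_zero_or_im_I_eq_one (K := 𝕜) with h0 | h1
    · exact h0
    · have := (RCLike.complexLinearIsometryEquiv h1).toLinearEquiv.finrank_eq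
      rw [h, Complex.finrank_real_complex] at this
      omega
  refine ⟨Complex.ofRealHom.comp (RCLike.realRingEquiv hI).toRingHom, fun z => ?_, fun z => ?_⟩
  · exact (Complex.norm_real _).trans ((RCLike.realLinearIsometryEquiv hI).norm_map z)
  · simp

/-- An element moved by conjugation excludes I = 0, so 𝕜 is a copy of ℂ. -/
theorem exists_ringHom_complex_of_star_ne {z₀ : 𝕜} (h : star z₀ ≠ z₀) :
    ∃ τ : 𝕜 →+* ℂ, (∀ z, ‖τ z‖ = ‖z‖) ∧ ∀ z, τ (star z) = star (τ z) := by
  have hI : RCLike.im (RCLike.I : 𝕜) = 1 := by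
    rcases RCLike.I_eq_zero_or_im_I_eq_one (K := 𝕜) with h0 | h1
    · refine absurd ?_ h
      rw [RCLike.star_def, RCLike.conj_eq_iff_im, ← RCLike.im_eq_zero h0]
    · exact h1
  refine ⟨(RCLike.complexRingEquiv hI).toRingHom, fun z => ?_, fun z => ?_⟩
  · exact (RCLike.complexLinearIsometryEquiv hI).norm_map z
  · apply Complex.ext <;> simp

/-- The infinite place given by the embedding, and the transfer of linear forms to it. -/
theorem exists_place_of_embedding (ι : K →+* 𝕜) (q : ℕ)
    (hcase : (Module.finrank ℝ 𝕜 = 1 ∧ q = 1) ∨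
      (Module.finrank ℝ 𝕜 = 2 ∧ q = 2 ∧ ∃ x : K, star (ι x) ≠ ι x)) :
    ∃ v : InfinitePlace K, (∀ x, v x = ‖ι x‖) ∧ v.mult = q ∧
      ∀ {d : ℕ} (M : Matrix (Fin d) (Fin d) 𝕜), ∃ M' : Matrix (Fin d) (Fin d) ℂ,
        (v.IsReal → ∀ i j, (M' i j).im = 0) ∧ ‖M'.det‖ = ‖M.det‖ ∧
        ∀ (φ : Fin d → K) j, ‖∑ a, M' j a * v.embedding (φ a)‖ = ‖∑ a, M j a * ι (φ a)‖ := by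
  obtain ⟨τ, hτ, hreal, hmult⟩ : ∃ τ : 𝕜 →+* ℂ, (∀ z, ‖τ z‖ = ‖z‖) ∧
      ((InfinitePlace.mk (τ.comp ι)).IsReal → ∀ z, (τ z).im = 0) ∧
      (InfinitePlace.mk (τ.comp ι)).mult = q := by
    rcases hcase with ⟨h1, rfl⟩ | ⟨-, rfl, x, hx⟩
    · obtain ⟨τ, hτ, him⟩ := exists_ringHom_complex_of_finrank_eq_one h1
      refine ⟨τ, hτ, fun _ => him, InfinitePlace.IsReal.mult_eq_one ?_⟩
      rw [InfinitePlace.isReal_mk_iff, ComplexEmbedding.isReal_iff]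
      ext x
      exact Complex.conj_eq_iff_im.2 (him (ι x))
    · obtain ⟨τ, hτ, hstar⟩ := exists_ringHom_complex_of_star_ne hx
      have hnr : ¬(InfinitePlace.mk (τ.comp ι)).IsReal := by
        rw [InfinitePlace.isReal_mk_iff, ComplexEmbedding.isReal_iff]
        intro h
        apply hx
        apply τ.injective
        rw [hstar]
        exact RingHom.congr_fun h x
      exact ⟨τ, hτ, fun h => absurd h hnr,
        InfinitePlace.IsComplex.mult_eq_two (InfinitePlace.not_isReal_iff_isComplex.1 hnr)⟩
  refine ⟨InfinitePlace.mk (τ.comp ι), fun x => ?_, hmult, fun {d} M => ?_⟩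
  · rw [InfinitePlace.apply]
    exact hτ _
  -- The chosen embedding of the place is either the given one or its conjugate; in the latter case
  -- the matrix of forms is conjugated too.
  · rcases InfinitePlace.embedding_mk_eq (τ.comp ι) with h | h
    · refine ⟨τ.mapMatrix M, fun hv i j => hreal hv _, ?_, fun φ j => ?_⟩
      · rw [← RingHom.map_det, hτ]
      · rw [h, ← hτ (∑ a, M j a * ι (φ a)), map_sum]
        simp
    · refine ⟨(starRingEnd ℂ).mapMatrix (τ.mapMatrix M), fun hv i j => ?_, ?_, fun φ j => ?_⟩
      · simp [hreal hv]
      · rw [← RingHom.map_det, ← RingHom.map_det, RCLike.norm_conj, hτ]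
      · rw [h, ← hτ (∑ a, M j a * ι (φ a)), map_sum, ← RCLike.norm_conj, map_sum]
        simp [ComplexEmbedding.conjugate_coe_eq]

end Transfer

end GoingDown
end

noncomputable section
namespace GoingDown

/-! ### Extension of scalars -/

open NumberField

section BaseChange

variable {𝕜 : Type*} [RCLike 𝕜] {K : Type*} [Field K] (ι : K →+* 𝕜) {n : ℕ}

local notation "𝔼" => EuclideanSpace 𝕜 (Fin n)

theorem embVec_sum_smul {α : Type*} (s : Finset α) (c : α → K) (x : α → Fin n → K) :
    embVec ι (∑ i ∈ s, c i • x i) = ∑ i ∈ s, ι (c i) • embVec ι (x i) := by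
  ext j
  simp [embVec]

/-- The extension to `𝕜ⁿ` of a linear functional on `Kⁿ`. -/
def extFunctional (l : (Fin n → K) →ₗ[K] K) : 𝔼 →ₗ[𝕜] 𝕜 :=
  ∑ j, ι (l (Pi.single j 1)) • (EuclideanSpace.proj j : 𝔼 →L[𝕜] 𝕜).toLinearMap

theorem extFunctional_embVec (l : (Fin n → K) →ₗ[K] K) (x : Fin n → K) :
    extFunctional ι l (embVec ι x) = ι (l x) := by
  have h : x = ∑ j, x j • (Pi.single j 1 : Fin n → K) := by
    ext i
    simp [Finset.sum_apply, Pi.single_apply]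
  conv_rhs => rw [h]
  simp [extFunctional, embVec, mul_comm]

/-- A non-zero maximal minor stays non-zero under the injective map ι. -/
theorem linearIndependent_embVec {d : ℕ} {w : Fin d → Fin n → K} (hw : LinearIndependent K w) :
    LinearIndependent 𝕜 fun i => embVec ι (w i) := by
  obtain ⟨I, hI⟩ := exists_plucker_ne_zero hw
  have h1 : LinearIndependent 𝕜 fun a j => ι (w a j) :=
    linearIndependent_of_plucker_ne_zero (I := I) (by rw [← map_plucker]; simpa using hI)
  exact h1.map' (WithLp.linearEquiv 2 𝕜 (Fin n → 𝕜)).symm.toLinearMap (LinearEquiv.ker _)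

theorem span_embVec_eq {d : ℕ} {w : Fin d → Fin n → K} {W : Submodule K (Fin n → K)}
    (hw : Submodule.span K (Set.range w) = W) :
    Submodule.span 𝕜 (embVec ι '' (W : Set (Fin n → K))) =
      Submodule.span 𝕜 (Set.range fun i => embVec ι (w i)) := by
  apply le_antisymm
  · rw [Submodule.span_le]
    rintro _ ⟨x, hx, rfl⟩
    rw [SetLike.mem_coe, ← hw] at hx
    obtain ⟨c, rfl⟩ := (Submodule.mem_span_range_iff_exists_fun K).1 hx
    rw [embVec_sum_smul]
    exact Submodule.sum_mem _ fun i _ => Submodule.smul_mem _ _ (Submodule.subset_span ⟨i, rfl⟩)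
  · refine Submodule.span_mono ?_
    rintro _ ⟨i, rfl⟩
    refine ⟨w i, ?_, rfl⟩
    rw [SetLike.mem_coe, ← hw]
    exact Submodule.subset_span ⟨i, rfl⟩

theorem finrank_span_embVec (W : Submodule K (Fin n → K)) :
    Module.finrank 𝕜 (Submodule.span 𝕜 (embVec ι '' (W : Set (Fin n → K)))) =
      Module.finrank K W := by
  let b := Module.finBasis K W
  have hli : LinearIndependent K fun i => ((b i : W) : Fin n → K) :=
    b.linearIndependent.map' W.subtype W.ker_subtype
  have hspan : Submodule.span K (Set.range fun i => ((b i : W) : Fin n → K)) = W := by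
    refine Submodule.eq_of_le_of_finrank_le ?_ ?_
    · rw [Submodule.span_le]
      rintro _ ⟨i, rfl⟩
      exact (b i).2
    · rw [finrank_span_eq_card hli]
      simp
  rw [span_embVec_eq ι hspan, finrank_span_eq_card (linearIndependent_embVec ι hli)]
  simp

theorem span_ratPoints_le (B : Submodule 𝕜 𝔼) :
    Submodule.span 𝕜 (embVec ι '' (ratPoints ι B : Set (Fin n → K))) ≤ B := by
  rw [Submodule.span_le]
  rintro _ ⟨x, hx, rfl⟩
  exact hx

theorem span_ratPoints_eq {B : Submodule 𝕜 𝔼} (hB : DefinedOver ι B) :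
    Submodule.span 𝕜 (embVec ι '' (ratPoints ι B : Set (Fin n → K))) = B := by
  refine le_antisymm (span_ratPoints_le ι B) ?_
  obtain ⟨s, rfl⟩ := hB
  refine Submodule.span_mono (Set.image_mono fun x hx => ?_)
  exact Submodule.subset_span ⟨x, hx, rfl⟩

theorem finrank_ratPoints {B : Submodule 𝕜 𝔼} (hB : DefinedOver ι B) :
    Module.finrank K (ratPoints ι B) = Module.finrank 𝕜 B := by
  rw [← finrank_span_embVec ι, span_ratPoints_eq ι hB]

/-- W is contained in the K-points of its span, and the two have equal dimension. So the height of
an extended subspace is computed on W itself. -/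
theorem ratPoints_span_embVec (W : Submodule K (Fin n → K)) :
    ratPoints ι (Submodule.span 𝕜 (embVec ι '' (W : Set (Fin n → K)))) = W := by
  symm
  refine Submodule.eq_of_le_of_finrank_le (fun x hx => Submodule.subset_span ⟨x, hx, rfl⟩) ?_
  rw [finrank_ratPoints ι ⟨_, rfl⟩, finrank_span_embVec]

end BaseChange

/-! ### Linear forms attached to an orthonormal basis. -/

section Orthonormal

variable {𝕜 : Type*} [RCLike 𝕜] {K : Type*} [Field K] {k n : ℕ}

local notation "𝔼" => EuclideanSpace 𝕜 (Fin n)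

/-- The linear forms coming from an orthonormal basis are adapted at the distinguished place. -/
theorem exists_adapted_orthonormal (ι : K →+* 𝕜) (v : InfinitePlace K) (hv : ∀ x, v x = ‖ι x‖)
    (htransfer : ∀ M : Matrix (Fin (k + 1)) (Fin (k + 1)) 𝕜,
      ∃ M' : Matrix (Fin (k + 1)) (Fin (k + 1)) ℂ,
        (v.IsReal → ∀ i j, (M' i j).im = 0) ∧ ‖M'.det‖ = ‖M.det‖ ∧
        ∀ (φ : Fin (k + 1) → K) j,
          ‖∑ a, M' j a * v.embedding (φ a)‖ = ‖∑ a, M j a * ι (φ a)‖)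
    (B : Submodule 𝕜 𝔼) (Z : OrthonormalBasis (Fin (k + 1)) 𝕜 B)
    (X : Fin (k + 1) → Fin n → 𝓞 K) (hXB : ∀ a, embVec ι (toField (X a)) ∈ B)
    (hX : ∃ I, plucker X I ≠ 0) :
    ∃ (M' : Matrix (Fin (k + 1)) (Fin (k + 1)) ℂ) (M : Matrix (Fin (k + 1)) (Fin (k + 1)) 𝕜),
      Adapted v X M' ∧ (∀ j, ((Z j : B) : 𝔼) = ∑ a, M j a • embVec ι (toField (X a))) ∧
      ∀ (φ : Fin (k + 1) → K) j,
          ‖∑ a, M' j a * v.embedding (φ a)‖ = ‖∑ a, M j a * ι (φ a)‖ := by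
  let x : Fin (k + 1) → B := fun a => ⟨embVec ι (toField (X a)), hXB a⟩
  -- U expresses X through Z, so U⁻¹ expresses Z through X: the forms with matrix U⁻¹ are the values
  -- of the functional at the vectors of Z.
  let U : Matrix (Fin (k + 1)) (Fin (k + 1)) 𝕜 := Matrix.of fun a j => inner 𝕜 (Z j) (x a)
  let z : Fin (k + 1) → Fin n → 𝕜 := fun j i => ((Z j : B) : 𝔼) i
  have hz1 : ∀ j i, ‖z j i‖ ≤ 1 := fun j i =>
    (PiLp.norm_apply_le _ _).trans (Z.orthonormal.1 j).le
  have hx : (fun a j => ι (X a j : K)) = fun a i => ∑ j, U a j * z j i := by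
    funext a i
    have h := congrArg (fun y : B => (y : 𝔼) i) (Z.sum_repr' (x a))
    simpa [x, U, z, embVec, toField] using h.symm
  obtain ⟨I, hI⟩ := hX
  have hU : U.det ≠ 0 := by
    intro h0
    have h1 := map_plucker_coe ι X I
    rw [hx, plucker_mul, h0, zero_mul] at h1
    apply hI
    simpa using h1
  have hUinv : ∀ a i, ∑ c, U⁻¹ a c * ι (X c i : K) = z a i := by
    intro a i
    have h1 : (U⁻¹.mulVec (U.mulVec fun j => z j i)) = fun j => z j i := by
      rw [Matrix.mulVec_mulVec, Matrix.nonsing_inv_mul _ (isUnit_iff_ne_zero.2 hU),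
        Matrix.one_mulVec]
    have h2 : (U.mulVec fun j => z j i) = fun c => ι (X c i : K) := by
      funext c
      exact (congrFun (congrFun hx c) i).symm
    rw [h2] at h1
    exact congrFun h1 a
  obtain ⟨M', hre, hdet, hforms⟩ := htransfer U⁻¹
  refine ⟨M', U⁻¹, ?_, fun j => ?_, hforms⟩
  · refine adapted_of_bounds v X M' hre ι hv U hU hdet hforms (fun a j => ?_) ?_
    · rw [hUinv]
      exact hz1 a j
    -- U is X times the conjugate transpose of Z, so Cauchy–Binet bounds its determinant by the
    -- minors of X.
    · have hUc : U = Matrix.of fun a b => ∑ i, ι (X a i : K) * star (z b i) := by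
        ext a b
        simp [U, x, embVec, toField, z, PiLp.inner_apply]
      rw [hUc]
      refine (norm_det_mul_le (fun a i => ι (X a i : K)) (fun i b => star (z b i))
        (fun i b => by rw [norm_star]; exact hz1 b i) (placeWedge_nonneg v X)
        fun J => ?_).trans ?_
      · rw [← map_plucker_coe, ← hv]
        exact le_placeNorm v (fun I => ((plucker X I : 𝓞 K) : K)) J
      · have := placeWedge_nonneg v X
        gcongr
        linarith
  · ext i
    have := hUinv j i
    simp only [z] at this
    simp [← this, embVec, toField]

end Orthonormal

/-! ### Hyperplanes of small height by Minkowski's theorem. -/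

variable {K : Type*} [Field K] [NumberField K] {n : ℕ}

theorem prod_place_weights (v₀ : InfinitePlace K) (f : InfinitePlace K → ℝ) (a s : ℝ)
    [DecidableEq (InfinitePlace K)] :
    ∏ v, (a * f v * (if v = v₀ then s else 1)) ^ v.mult =
      a ^ Module.finrank ℚ K * (∏ v, f v ^ v.mult) * s ^ v₀.mult := by
  simp only [mul_pow, Finset.prod_mul_distrib]
  rw [Finset.prod_pow_eq_pow_sum, InfinitePlace.sum_mult_eq]
  congr 1
  rw [Finset.prod_eq_single v₀]
  · simp
  · intro v _ hv
    simp [hv]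
  · simp

theorem exists_functional_of_linearIndependent {F : Type*} [Field F] {d : ℕ}
    {X : Fin d → Fin n → F} (hX : LinearIndependent F X) (φ : Fin d → F) :
    ∃ l : (Fin n → F) →ₗ[F] F, ∀ a, l (X a) = φ a := by
  obtain ⟨g, hg⟩ := LinearMap.exists_leftInverse_of_injective (Fintype.linearCombination F X)
    (LinearMap.ker_eq_bot.2 hX.fintypeLinearCombination_injective)
  refine ⟨(Fintype.linearCombination F φ) ∘ₗ g, fun a => ?_⟩
  have h := LinearMap.congr_fun hg (Pi.single a 1)
  simp only [LinearMap.comp_apply, Fintype.linearCombination_apply_single, one_smul,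
    LinearMap.id_apply] at h
  simp [h]

section Hyperplane

variable {𝕜 : Type*} [RCLike 𝕜]

/-- A hyperplane of `B` defined over `K` of small height whose equation is small at prescribed
vectors of an orthonormal basis. -/
theorem exists_hyperplane_small (ι : K →+* 𝕜) (q : ℕ)
    (hcase : (Module.finrank ℝ 𝕜 = 1 ∧ q = 1) ∨
      (Module.finrank ℝ 𝕜 = 2 ∧ q = 2 ∧ ∃ x : K, star (ι x) ≠ ι x)) (k n : ℕ) :
    ∃ C : ℝ, 1 ≤ C ∧ ∀ B : Submodule 𝕜 (EuclideanSpace 𝕜 (Fin n)),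
      Module.finrank 𝕜 B = k + 1 + 1 →
      DefinedOver ι B → ∀ (Z : OrthonormalBasis (Fin (k + 1 + 1)) 𝕜 B) (R : ℝ)
        (δ : Fin (k + 1 + 1) → ℝ), 0 < R → (∀ j, 0 < δ j) → (∀ j, δ j ≤ 1) →
        C ≤ height ι B * R ^ (k + 1 + 1) * ∏ j, δ j ^ q →
        ∃ (ψ : EuclideanSpace 𝕜 (Fin n) →ₗ[𝕜] 𝕜) (ρ : ℝ), 1 ≤ ρ ∧
          (∀ j, ‖ψ (Z j : B)‖ ≤ ρ * δ j) ∧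
          (∃ j, ‖ψ (Z j : B)‖ = 1) ∧
          Module.finrank 𝕜 (B ⊓ LinearMap.ker ψ : Submodule 𝕜 (EuclideanSpace 𝕜 (Fin n))) =
            k + 1 ∧
          DefinedOver ι (B ⊓ LinearMap.ker ψ) ∧
          height ι (B ⊓ LinearMap.ker ψ) * ρ ^ q ≤ C * height ι B * R := by
  classical
  obtain ⟨v₀, hv₀, hmult, htransfer⟩ := exists_place_of_embedding ι q hcase
  obtain ⟨Cb, hCb⟩ := exists_almost_free_basis K (k + 1 + 1) n
  obtain ⟨Cm, hCm0, hCm⟩ := exists_integral_small_forms K (k + 1 + 1)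
  set p := Module.finrank ℚ K with hp
  have hp0 : p ≠ 0 := Module.finrank_pos.ne'
  set F := formConst (k + 1) n with hF
  have hF1 : 1 ≤ F := one_le_formConst _ _
  have hFp : 1 ≤ F ^ p := one_le_pow₀ hF1
  refine ⟨F ^ p * (Cm + 1) * (Cb + 1), ?_, fun B hBrank hB Z R δ hR hδ hδ1 hcond => ?_⟩
  · refine one_le_mul_of_one_le_of_one_le (one_le_mul_of_one_le_of_one_le hFp ?_) ?_
    · linarith
    · simp
  set S := ratPoints ι B with hS
  have hSrank : Module.finrank K S = k + 1 + 1 := by rw [hS, finrank_ratPoints ι hB, hBrank]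
  obtain ⟨X, hXS, hX, hXnorm⟩ := hCb S hSrank
  have hheight : height ι B =
      (Ideal.absNorm (Ideal.span (Set.range (plucker X))) : ℝ)⁻¹ *
        ∏ v, placeWedge v X ^ v.mult := by
    rw [height, subspaceHeight_eq_of_integralPoints S hSrank X hXS hX,
      familyHeight_of_integral _ _ (plucker_toField X)]
    simp only [placeWedge, funext (plucker_toField X)]
  have hXB : ∀ a, embVec ι (toField (X a)) ∈ B := fun a => hXS a
  set W := ∏ v, placeWedge v X ^ v.mult with hW
  have hNpos : (0 : ℝ) < Ideal.absNorm (Ideal.span (Set.range (plucker X))) := by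
    obtain ⟨I, hI⟩ := hX
    exact_mod_cast absNorm_span_pos hI
  have hN1 : (1 : ℝ) ≤ Ideal.absNorm (Ideal.span (Set.range (plucker X))) := by
    exact_mod_cast hNpos
  have hW0 : 0 ≤ W := Finset.prod_nonneg fun v _ => pow_nonneg (placeWedge_nonneg v X) _
  have hheight_le : height ι B ≤ W := by
    rw [hheight]
    exact mul_le_of_le_one_left hW0 (inv_le_one_of_one_le₀ hN1)
  -- The bounded norm of the ideal of minors is needed here. This direction enters the final height
  -- bound, `hheight_le` enters Minkowski's condition.
  have hle_height : W ≤ Cb * height ι B := by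
    have h1 : W = Ideal.absNorm (Ideal.span (Set.range (plucker X))) * height ι B := by
      rw [hheight, mul_inv_cancel_left₀ hNpos.ne']
    rw [h1]
    have : 0 ≤ height ι B := (subspaceHeight_pos _).le
    gcongr
  obtain ⟨M₀, M𝕜, hM₀, hZM, hforms⟩ := exists_adapted_orthonormal ι v₀ hv₀
    (fun M => htransfer M) B Z X hXB hX
  choose M₁ hM₁ using fun v : InfinitePlace K => exists_adapted v X hX
  let M : InfinitePlace K → Matrix (Fin (k + 1 + 1)) (Fin (k + 1 + 1)) ℂ :=
    fun v => if v = v₀ then M₀ else M₁ v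
  have hM : ∀ v, Adapted v X (M v) := by
    intro v
    by_cases hv : v = v₀
    · subst hv
      simpa [M] using hM₀
    · simpa [M, hv] using hM₁ v
  -- The same bound T is imposed at every place; since the multiplicities add up to p, its total
  -- contribution is T^p = R.
  set T : ℝ := R ^ ((p : ℝ)⁻¹) with hT
  have hT0 : 0 < T := Real.rpow_pos_of_pos hR _
  have hTp : T ^ p = R := Real.rpow_inv_natCast_pow hR.le hp0
  have hcond' : Cm < ∏ v, (‖(M v).det‖⁻¹ *
      ∏ j, T * (if v = v₀ then δ j else 1)) ^ v.mult := by
    have h1 : ∏ v, (F⁻¹ * T ^ (k + 1 + 1) * placeWedge v X *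
        (if v = v₀ then ∏ j, δ j else 1)) ^ v.mult ≤ ∏ v, (‖(M v).det‖⁻¹ *
      ∏ j, T * (if v = v₀ then δ j else 1)) ^ v.mult := by
      refine Finset.prod_le_prod (fun v _ => ?_) fun v _ => ?_
      · have := placeWedge_nonneg v X
        have h2 : 0 ≤ (if v = v₀ then ∏ j, δ j else 1) := by
          split_ifs
          · exact Finset.prod_nonneg fun j _ => (hδ j).le
          · exact zero_le_one
        positivity
      · have := placeWedge_nonneg v X
        have h2 : 0 ≤ (if v = v₀ then ∏ j, δ j else 1) := by
          split_ifs
          · exact Finset.prod_nonneg fun j _ => (hδ j).le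
          · exact zero_le_one
        have h3 : ∏ j, T * (if v = v₀ then δ j else 1) =
            T ^ (k + 1 + 1) * (if v = v₀ then ∏ j, δ j else 1) := by
          rw [Finset.prod_mul_distrib]
          split_ifs <;> simp
        have h4 : F⁻¹ * placeWedge v X ≤ ‖(M v).det‖⁻¹ := by
          rw [inv_mul_le_iff₀ (by linarith)]
          exact (hM v).wedge_le
        rw [h3]
        refine pow_le_pow_left₀ (by positivity) ?_ _
        calc _ = (F⁻¹ * placeWedge v X) *
              (T ^ (k + 1 + 1) * (if v = v₀ then ∏ j, δ j else 1)) := by ring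
          _ ≤ _ := by gcongr
    refine lt_of_lt_of_le ?_ h1
    rw [prod_place_weights, hmult, ← hp, ← hW, mul_pow, ← pow_mul, mul_comm (k + 1 + 1) p, pow_mul,
      hTp, inv_pow, ← Finset.prod_pow]
    have hpos : 0 ≤ ∏ j, δ j ^ q := Finset.prod_nonneg fun j _ => pow_nonneg (hδ j).le _
    have h5 : F ^ p * (Cm + 1) ≤ W * R ^ (k + 1 + 1) * ∏ j, δ j ^ q := by
      calc F ^ p * (Cm + 1) ≤ F ^ p * (Cm + 1) * (Cb + 1) :=
            le_mul_of_one_le_right (by positivity) (by simp)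
        _ ≤ _ := hcond
        _ ≤ _ := by gcongr
    have h6 : Cm + 1 ≤ (F ^ p)⁻¹ * R ^ (k + 1 + 1) * W * ∏ j, δ j ^ q := by
      rw [mul_assoc, mul_assoc, ← div_eq_inv_mul, le_div_iff₀ (by linarith)]
      linarith
    linarith
  obtain ⟨φ, hφ, hφt⟩ := hCm M (fun v => (hM v).im_eq_zero) (fun v => (hM v).det_ne_zero)
    (fun v j => T * (if v = v₀ then δ j else 1))
    (fun v j => by
      have := hδ j
      split_ifs <;> positivity) hcond'
  obtain ⟨l, hl⟩ := exists_functional_of_linearIndependent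
    (linearIndependent_toField_iff.2 hX) fun a => (φ a : K)
  set ψ₀ := extFunctional ι l with hψ₀
  have hψX : ∀ a, ψ₀ (embVec ι (toField (X a))) = ι (φ a) := fun a => by
    rw [hψ₀, extFunctional_embVec, hl]
  have hψZ : ∀ j, ψ₀ (Z j : B) = ∑ a, M𝕜 j a * ι (φ a) := fun j => by
    rw [hZM, map_sum]
    simp only [map_smul, hψX, smul_eq_mul]
  have hψZle : ∀ j, ‖ψ₀ (Z j : B)‖ ≤ T * δ j := fun j => by
    have h1 := hφt v₀ j
    simp only [M, if_true] at h1
    rw [hψZ, ← hforms fun a => (φ a : K)]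
    exact h1.le
  obtain ⟨m, -, hm⟩ := Finset.exists_max_image Finset.univ (fun j => ‖ψ₀ (Z j : B)‖)
    ⟨0, Finset.mem_univ _⟩
  set N := ‖ψ₀ (Z m : B)‖ with hN
  obtain ⟨a, ha⟩ := Function.ne_iff.1 hφ
  have ha' : ι (φ a) ≠ 0 := by simpa using ha
  have hN0 : 0 < N := by
    by_contra hle
    apply ha'
    rw [← hψX a]
    have h1 := congrArg (fun y : B => ψ₀ (y : EuclideanSpace 𝕜 (Fin n))) (Z.sum_repr' ⟨_, hXB a⟩)
    simp only [Submodule.coe_sum, Submodule.coe_smul, map_sum, map_smul] at h1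
    rw [← h1]
    refine Finset.sum_eq_zero fun j _ => ?_
    have : ‖ψ₀ (Z j : B)‖ ≤ 0 := (hm j (Finset.mem_univ _)).trans (not_lt.1 hle)
    rw [norm_le_zero_iff.1 this, smul_zero]
  have hNT : N ≤ T := (hψZle m).trans (mul_le_of_le_one_right hT0.le (hδ1 m))
  have hNne : ((N : ℝ) : 𝕜)⁻¹ ≠ 0 := inv_ne_zero (by exact_mod_cast hN0.ne')
  have hker : LinearMap.ker ((((N : ℝ) : 𝕜)⁻¹) • ψ₀) = LinearMap.ker ψ₀ :=
    LinearMap.ker_smul _ _ hNne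
  have hnorm : ∀ y, ‖((((N : ℝ) : 𝕜)⁻¹) • ψ₀) y‖ = ‖ψ₀ y‖ / N := fun y => by
    rw [LinearMap.smul_apply, norm_smul, norm_inv, RCLike.norm_ofReal, abs_of_pos hN0,
      inv_mul_eq_div]
  set S' : Submodule K (Fin n → K) := S ⊓ LinearMap.ker l with hS'
  have hS'rank : Module.finrank K S' = k + 1 :=
    finrank_inf_ker S hSrank l (hXS a) (by rw [hl]; simpa using ha)
  have hBrank' : Module.finrank 𝕜
      (B ⊓ LinearMap.ker ψ₀ : Submodule 𝕜 (EuclideanSpace 𝕜 (Fin n))) = k + 1 :=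
    finrank_inf_ker B hBrank ψ₀ (hXB a) (by rw [hψX]; exact ha')
  have hspan : Submodule.span 𝕜 (embVec ι '' (S' : Set (Fin n → K))) = B ⊓ LinearMap.ker ψ₀ := by
    refine Submodule.eq_of_le_of_finrank_le ?_ ?_
    · rw [Submodule.span_le]
      rintro _ ⟨x, ⟨hx1, hx2⟩, rfl⟩
      refine ⟨hx1, ?_⟩
      rw [SetLike.mem_coe, LinearMap.mem_ker] at hx2 ⊢
      rw [hψ₀, extFunctional_embVec, hx2, map_zero]
    · rw [hBrank', finrank_span_embVec, hS'rank]
  -- Dividing by N normalises the maximum on Z to 1; the bound T δ_j becomes ρ δ_j with ρ = T / N.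
  refine ⟨((N : ℝ) : 𝕜)⁻¹ • ψ₀, T / N, (one_le_div hN0).2 hNT, fun j => ?_, ⟨m, ?_⟩, ?_, ?_, ?_⟩
  · rw [hnorm, div_mul_eq_mul_div]
    gcongr
    exact hψZle j
  · rw [hnorm, ← hN, div_self hN0.ne']
  · rw [hker, hBrank']
  · rw [hker]
    exact ⟨_, hspan⟩
  · rw [hker, ← hspan, height, ratPoints_span_embVec]
    have h1 := subspaceHeight_inf_ker_le S hSrank X hXS hX φ hφ l hl
    -- At v₀ the true maximum N replaces T, which saves (N/T)^q and pays for the factor ρ^q in the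
    -- conclusion.
    have h2 : ∏ v, placeNorm v (fun J => ((contraction φ X J : 𝓞 K) : K)) ^ v.mult ≤
        ∏ v, (F * T * placeWedge v X * (if v = v₀ then N / T else 1)) ^ v.mult := by
      refine Finset.prod_le_prod (fun v _ => pow_nonneg (placeNorm_nonneg _ _) _) fun v _ => ?_
      refine pow_le_pow_left₀ (placeNorm_nonneg _ _) ?_ _
      have h3 : F * T * placeWedge v X * (if v = v₀ then N / T else 1) =
          F * placeWedge v X * (if v = v₀ then N else T) := by
        split_ifs
        · field_simp
        · ring
      rw [h3]
      refine (hM v).contraction_le φ _ (by split_ifs <;> positivity) fun j => ?_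
      by_cases hv : v = v₀
      · subst hv
        rw [if_pos rfl]
        have h4 := hm j (Finset.mem_univ _)
        rw [hψZ, ← hforms fun a => (φ a : K)] at h4
        simpa [M] using h4
      · have h4 := (hφt v j).le
        simpa [hv] using h4
    rw [prod_place_weights, hmult, ← hp, ← hW, mul_pow, hTp] at h2
    have h5 : (N / T) ^ q * (T / N) ^ q = 1 := by
      rw [← mul_pow, div_mul_div_cancel₀ hT0.ne', div_self hN0.ne', one_pow]
    have hBpos : 0 ≤ height ι B := (subspaceHeight_pos _).le
    calc subspaceHeight S' * (T / N) ^ q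
        ≤ (F ^ p * R * W * (N / T) ^ q) * (T / N) ^ q := by
          gcongr
          exact h1.trans h2
      _ = F ^ p * R * W := by rw [mul_assoc, h5, mul_one]
      _ ≤ F ^ p * R * (Cb * height ι B) := by gcongr
      _ = F ^ p * 1 * Cb * height ι B * R := by ring
      _ ≤ F ^ p * (Cm + 1) * (Cb + 1) * height ι B * R := by
          gcongr <;> linarith

end Hyperplane

end GoingDown
end

noncomputable section
namespace GoingDown

/-! ### The going-down step -/

section Geometry

variable {𝕜 : Type*} [RCLike 𝕜] {n : ℕ}

local notation "𝔼" => EuclideanSpace 𝕜 (Fin n)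

/-- An orthonormal basis of `B` triangular with respect to the projections of given vectors. -/
theorem exists_triangular_basis (B : Submodule 𝕜 𝔼) {d e : ℕ} (hB : Module.finrank 𝕜 B = e)
    (x : Fin d → 𝔼) : ∃ Z : OrthonormalBasis (Fin e) 𝕜 B, ∀ (j : Fin d) (m : Fin e),
      (j : ℕ) < m → inner 𝕜 ((Z m : B) : 𝔼) (B.starProjection (x j)) = 0 := by
  -- Gram–Schmidt is applied to the projections of the x_j, cut off at e vectors or padded by 0 up
  -- to e.
  let f : Fin e → B := fun m =>
    if hm : (m : ℕ) < d then B.orthogonalProjectionOnto (x ⟨m, hm⟩) else 0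
  have hcard : Module.finrank 𝕜 B = Fintype.card (Fin e) := by simp [hB]
  obtain ⟨Z, hZ⟩ : ∃ Z : OrthonormalBasis (Fin e) 𝕜 B, ∀ i j, i < j → inner 𝕜 (Z j) (f i) = 0 :=
    ⟨InnerProductSpace.gramSchmidtOrthonormalBasis hcard f, fun i j hij =>
      InnerProductSpace.gramSchmidtOrthonormalBasis_inv_triangular hcard f hij⟩
  refine ⟨Z, fun j m hjm => ?_⟩
  have hf : f ⟨j, hjm.trans m.2⟩ = B.orthogonalProjectionOnto (x j) := dif_pos j.2
  have h := hZ ⟨j, hjm.trans m.2⟩ m hjm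
  rw [hf, Submodule.coe_inner] at h
  exact h

theorem exists_coeff_of_mem_span {d : ℕ} (x : Fin d → 𝔼) (i : Fin d) {u : 𝔼}
    (hu : u ∈ Submodule.span 𝕜 (Set.range fun j : Fin (i + 1) => x (Fin.castLE i.2 j))) :
    ∃ t : Fin d → 𝕜, (∀ j, i < j → t j = 0) ∧ u = ∑ j, t j • x j := by
  obtain ⟨c, rfl⟩ := (Submodule.mem_span_range_iff_exists_fun 𝕜).1 hu
  refine ⟨∑ j, Pi.single (Fin.castLE i.2 j) (c j), fun j hj => ?_, ?_⟩
  · rw [Finset.sum_apply]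
    refine Finset.sum_eq_zero fun m _ => Pi.single_eq_of_ne ?_ _
    intro h
    have h1 : (j : ℕ) = m := congrArg Fin.val h
    have h2 : (i : ℕ) < j := hj
    omega
  · simp only [Finset.sum_apply, Finset.sum_smul]
    rw [Finset.sum_comm]
    refine Finset.sum_congr rfl fun m _ => ?_
    simp [Pi.single_apply, ite_smul]

/-- The span of the first i + 1 principal vectors serves as test space. By triangularity their
projections involve only basis vectors where ψ is at most ε, so ψ is small on these projections. -/
theorem omega_inf_ker_le {A B : Submodule 𝕜 𝔼} {d e : ℕ} {x : Fin d → 𝔼}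
    (hx : Orthonormal 𝕜 x) (hxA : ∀ j, x j ∈ A) {i : Fin d}
    (hclose : ∀ t : Fin d → 𝕜, (∀ j, i < j → t j = 0) →
        ‖(∑ j, t j • x j) - B.starProjection (∑ j, t j • x j)‖ ≤
          distConst n * omega (i + 1) A B * ‖∑ j, t j • x j‖)
    (Z : OrthonormalBasis (Fin e) 𝕜 B)
    (hZ : ∀ (j : Fin d) (m : Fin e),
      (j : ℕ) < m → inner 𝕜 ((Z m : B) : 𝔼) (B.starProjection (x j)) = 0)
    {ψ : 𝔼 →ₗ[𝕜] 𝕜} {ε : ℝ} (hε : 0 ≤ ε) (hψ : ∀ m : Fin e, (m : ℕ) ≤ i → ‖ψ (Z m : B)‖ ≤ ε)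
    (hψ1 : ∃ m, ‖ψ (Z m : B)‖ = 1) (hne : B ⊓ LinearMap.ker ψ ≠ ⊥) :
    omega (i + 1) A (B ⊓ LinearMap.ker ψ) ≤
      distConst n * (distConst n * omega (i + 1) A B + d * (e * ε)) := by
  have homega := omega_nonneg (i + 1) A B
  have hD := distConst_pos n
  refine omega_le (F := Submodule.span 𝕜 (Set.range fun j : Fin (i + 1) => x (Fin.castLE i.2 j)))
    hne ?_ ?_ (by positivity) fun u hu => ?_
  · rw [Submodule.span_le]
    rintro _ ⟨j, rfl⟩
    exact hxA _
  · exact (finrank_span_eq_card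
      (hx.linearIndependent.comp (Fin.castLE i.2) (Fin.castLE_injective _))).trans
      (Fintype.card_fin _)
  · obtain ⟨t, ht, rfl⟩ := exists_coeff_of_mem_span x i hu
    set u := ∑ j, t j • x j with hu'
    have htu : ∀ j, ‖t j‖ ≤ ‖u‖ := by
      intro j
      rw [← hx.inner_right_fintype t j]
      refine (norm_inner_le_norm _ _).trans ?_
      rw [hx.1 j, one_mul]
    have hψx : ∀ j, j ≤ i → ‖ψ (B.starProjection (x j))‖ ≤ e * ε := by
      intro j hj
      have h1 := congrArg (fun y : B => ψ (y : 𝔼))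
        (Z.sum_repr' ⟨B.starProjection (x j), B.starProjection_apply_mem _⟩)
      simp only [Submodule.coe_sum, Submodule.coe_smul, map_sum, map_smul] at h1
      rw [← h1]
      refine (norm_sum_le _ _).trans ?_
      calc ∑ m, ‖inner 𝕜 (Z m) (⟨B.starProjection (x j), B.starProjection_apply_mem _⟩ : B) •
            ψ (Z m : B)‖ ≤ ∑ _m : Fin e, ε := by
            refine Finset.sum_le_sum fun m _ => ?_
            rw [norm_smul]
            rcases lt_or_ge (j : ℕ) m with hjm | hjm
            · have h2 : inner 𝕜 (Z m)
                  (⟨B.starProjection (x j), B.starProjection_apply_mem _⟩ : B) = 0 := hZ j m hjm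
              rw [h2, norm_zero, zero_mul]
              exact hε
            · have h3 : ‖inner 𝕜 (Z m)
                  (⟨B.starProjection (x j), B.starProjection_apply_mem _⟩ : B)‖ ≤ 1 := by
                refine (norm_inner_le_norm _ _).trans ?_
                rw [Z.orthonormal.1 m, one_mul]
                exact (B.norm_starProjection_apply_le (x j)).trans (hx.1 j).le
              calc _ ≤ 1 * ε := by
                    gcongr
                    exact hψ m (hjm.trans hj)
                _ = ε := one_mul ε
        _ = e * ε := by simp
    obtain ⟨m, hm⟩ := hψ1
    have hm0 : ψ (Z m : B) ≠ 0 := by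
      rw [← norm_pos_iff, hm]
      exact one_pos
    have hψu : ‖ψ (B.starProjection u)‖ ≤ d * (e * ε) * ‖u‖ := by
      rw [hu']
      simp only [map_sum, map_smul]
      refine (norm_sum_le _ _).trans ?_
      calc ∑ j, ‖t j • ψ (B.starProjection (x j))‖ ≤ ∑ _j : Fin d, ‖u‖ * (e * ε) := by
            refine Finset.sum_le_sum fun j _ => ?_
            rw [norm_smul]
            rcases lt_or_ge i j with hj | hj
            · rw [ht j hj, norm_zero, zero_mul]
              positivity
            · exact mul_le_mul (htu j) (hψx j hj) (norm_nonneg _) (norm_nonneg _)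
        _ = d * (e * ε) * ‖u‖ := by
            simp
            ring
    -- The projection of u is pushed into the kernel along a vector Z_m with |ψ(Z_m)| = 1, so the
    -- correction is no longer than |ψ(P u)|.
    refine ⟨B.starProjection u - (ψ (B.starProjection u) / ψ (Z m : B)) • ((Z m : B) : 𝔼),
      ⟨?_, ?_⟩, ?_⟩
    · exact B.sub_mem (B.starProjection_apply_mem _) (B.smul_mem _ (Z m).2)
    · rw [SetLike.mem_coe, LinearMap.mem_ker, map_sub, map_smul, smul_eq_mul,
        div_mul_cancel₀ _ hm0, sub_self]
    · rw [sub_sub_eq_add_sub, add_sub_right_comm]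
      refine (norm_add_le _ _).trans ?_
      rw [add_mul]
      refine add_le_add (hclose t ht) ?_
      have hZ1 : ‖((Z m : B) : 𝔼)‖ = 1 := Z.orthonormal.1 m
      rw [norm_smul, norm_div, hm, div_one, hZ1, mul_one]
      exact hψu

end Geometry

section Step

variable {𝕜 : Type*} [RCLike 𝕜] {K : Type*} [Field K] [NumberField K]

theorem add_pow_le_two_mul_max {a b : ℝ} (ha : 0 ≤ a) (hb : 0 ≤ b) (q : ℕ) :
    (a + b) ^ q ≤ 2 ^ q * (a ^ q + b ^ q) := by
  have h1 : (a + b) ^ q ≤ (2 * max a b) ^ q := by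
    refine pow_le_pow_left₀ (by positivity) ?_ q
    linarith [le_max_left a b, le_max_right a b]
  refine h1.trans ?_
  rw [mul_pow]
  gcongr
  rcases max_choice a b with h | h <;> rw [h]
  · linarith [pow_nonneg hb q]
  · linarith [pow_nonneg ha q]

/-- One step down for fixed dimensions, with free parameters `R` and `δ`. -/
theorem exists_going_down_step_of_dim (ι : K →+* 𝕜) (q : ℕ)
    (hcase : (Module.finrank ℝ 𝕜 = 1 ∧ q = 1) ∨
      (Module.finrank ℝ 𝕜 = 2 ∧ q = 2 ∧ ∃ x : K, star (ι x) ≠ ι x)) (k n : ℕ) :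
    ∃ C : ℝ, 1 ≤ C ∧ ∀ (h : ℕ) (A B : Submodule 𝕜 (EuclideanSpace 𝕜 (Fin n))) (R : ℝ)
      (δ : Fin h → ℝ), Module.finrank 𝕜 B = k + 1 + 1 → h ≤ Module.finrank 𝕜 A → h ≤ k + 1 →
      DefinedOver ι B → 0 < R → (∀ i, 0 < δ i) → (∀ i, δ i ≤ 1) → Monotone δ →
      C ≤ height ι B * R ^ (k + 1 + 1) * ∏ i, δ i ^ q →
      ∃ B' : Submodule 𝕜 (EuclideanSpace 𝕜 (Fin n)), B' ≤ B ∧ Module.finrank 𝕜 B' = k + 1 ∧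
        DefinedOver ι B' ∧ height ι B' ≤ C * height ι B * R ∧
        ∀ i : Fin h, height ι B' * omega (i + 1) A B' ^ q ≤
          C * height ι B * R * (omega (i + 1) A B ^ q + δ i ^ q) := by
  obtain ⟨C, hC1, hC⟩ := exists_hyperplane_small ι q hcase k n
  set D := distConst n with hD
  have hD0 : 0 < D := distConst_pos n
  set E : ℝ := (D * (D + n * n + 1)) ^ q * 2 ^ q with hE
  have hE0 : 0 ≤ E := by positivity
  refine ⟨C * (E + 1), one_le_mul_of_one_le_of_one_le hC1 (by linarith),
    fun h A B R δ hBrank hA hk hB hR hδ hδ1 hmono hcond => ?_⟩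
  have hBpos : 0 < height ι B := subspaceHeight_pos _
  have hBne : B ≠ ⊥ := by
    rintro rfl
    simp at hBrank
  obtain ⟨x, hx, hxA, hclose⟩ := exists_orthonormal_close A B hBne rfl
  obtain ⟨Z, hZ⟩ := exists_triangular_basis B hBrank x
  -- No smallness is asked beyond the first h vectors; padding with 1 leaves the product in
  -- Minkowski's condition unchanged.
  let δ' : Fin (k + 1 + 1) → ℝ := fun j => if hj : (j : ℕ) < h then δ ⟨j, hj⟩ else 1
  have hprod : ∏ j, δ' j ^ q = ∏ i, δ i ^ q := by
    have hlt : h ≤ k + 1 + 1 := by omega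
    symm
    refine Finset.prod_of_injOn (Fin.castLE hlt) (Fin.castLE_injective hlt).injOn (by simp)
      (fun j _ hj => ?_) (fun i _ => by simp [δ'])
    have : ¬ (j : ℕ) < h := fun hjh => hj ⟨⟨j, hjh⟩, by simp, rfl⟩
    simp [δ', this]
  obtain ⟨ψ, ρ, hρ, hψ, hψ1, hrank, hdef, hht⟩ := hC B hBrank hB Z R δ' hR
    (fun j => by
      simp only [δ']
      split_ifs
      exacts [hδ _, one_pos])
    (fun j => by
      simp only [δ']
      split_ifs
      exacts [hδ1 _, le_rfl])
    (by
      rw [hprod]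
      exact (le_mul_of_one_le_right (by linarith) (by linarith)).trans hcond)
  set B' := B ⊓ LinearMap.ker ψ with hB'
  have hB'pos : 0 < height ι B' := subspaceHeight_pos _
  have hCR : C * height ι B * R ≤ C * (E + 1) * height ι B * R := by
    have : C ≤ C * (E + 1) := le_mul_of_one_le_right (by linarith) (by linarith)
    gcongr
  refine ⟨B', inf_le_left, hrank, hdef, ?_, fun i => ?_⟩
  · refine le_trans ?_ hCR
    exact (le_mul_of_one_le_right hB'pos.le (one_le_pow₀ hρ)).trans hht
  · have hB'ne : B' ≠ ⊥ := by
      intro h0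
      rw [h0] at hrank
      simp at hrank
    have hAn : Module.finrank 𝕜 A ≤ n := by
      simpa using A.finrank_le
    have hBn : k + 1 + 1 ≤ n := by
      have := B.finrank_le
      rw [hBrank] at this
      simpa using this
    have hρ0 : 0 < ρ := by linarith
    have hω := omega_nonneg (i + 1) A B
    have hδi := hδ i
    have hψi : ∀ m : Fin (k + 1 + 1), (m : ℕ) ≤ (Fin.castLE hA i : Fin _) →
        ‖ψ (Z m : B)‖ ≤ ρ * δ i := by
      intro m hm
      refine (hψ m).trans ?_
      have hmi : (m : ℕ) ≤ i := hm
      have hmh : (m : ℕ) < h := hmi.trans_lt i.2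
      have : δ' m ≤ δ i := by
        simp only [δ', hmh, dif_pos]
        exact hmono hmi
      gcongr
    have h1 : omega (i + 1) A B' ≤ D * (D * omega (i + 1) A B +
        (Module.finrank 𝕜 A : ℝ) * ((k + 1 + 1 : ℕ) * (ρ * δ i))) :=
      omega_inf_ker_le hx hxA (i := Fin.castLE hA i) (hclose (Fin.castLE hA i)) Z hZ
        (by positivity) hψi hψ1 hB'ne
    -- Since ρ ≥ 1, the term in ω may be multiplied by ρ as well; then ρ^q factors out and is
    -- absorbed by the height bound.
    have h2 : omega (i + 1) A B' ≤ (D * (D + n * n + 1)) * ρ * (omega (i + 1) A B + δ i) := by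
      calc omega (i + 1) A B' ≤ D * (D * omega (i + 1) A B + n * (n * (ρ * δ i))) := by
            refine h1.trans ?_
            gcongr
        _ ≤ D * (D * (ρ * omega (i + 1) A B) + n * (n * (ρ * δ i))) := by
            have : omega (i + 1) A B ≤ ρ * omega (i + 1) A B := le_mul_of_one_le_left hω hρ
            gcongr
        _ ≤ D * ((D + n * n + 1) * (ρ * omega (i + 1) A B) +
              (D + n * n + 1) * (ρ * δ i)) := by
            rw [← mul_assoc (n : ℝ) n]
            have hn : (0 : ℝ) ≤ n * n := by positivity
            gcongr <;> linarith
        _ = _ := by ring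
    calc height ι B' * omega (i + 1) A B' ^ q
        ≤ height ι B' * ((D * (D + n * n + 1)) * ρ * (omega (i + 1) A B + δ i)) ^ q := by
          have := omega_nonneg (i + 1) A B'
          gcongr
      _ = (height ι B' * ρ ^ q) * ((D * (D + n * n + 1)) ^ q * (omega (i + 1) A B + δ i) ^ q) := by
          rw [mul_pow, mul_pow]
          ring
      _ ≤ (C * height ι B * R) * ((D * (D + n * n + 1)) ^ q *
            (2 ^ q * (omega (i + 1) A B ^ q + δ i ^ q))) := by
          gcongr
          exact add_pow_le_two_mul_max hω hδi.le q
      _ = C * E * height ι B * R * (omega (i + 1) A B ^ q + δ i ^ q) := by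
          rw [hE]
          ring
      _ ≤ C * (E + 1) * height ι B * R * (omega (i + 1) A B ^ q + δ i ^ q) := by
          gcongr
          linarith

/-- One step down, with free parameters `R` and `δ`. -/
theorem exists_going_down_step (ι : K →+* 𝕜) (q : ℕ)
    (hcase : (Module.finrank ℝ 𝕜 = 1 ∧ q = 1) ∨
      (Module.finrank ℝ 𝕜 = 2 ∧ q = 2 ∧ ∃ x : K, star (ι x) ≠ ι x)) (n : ℕ) :
    ∃ C : ℝ, 1 ≤ C ∧ ∀ (h e : ℕ) (A B : Submodule 𝕜 (EuclideanSpace 𝕜 (Fin n))) (R : ℝ)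
      (δ : Fin h → ℝ), 1 ≤ h → Module.finrank 𝕜 B = e → h ≤ Module.finrank 𝕜 A → h ≤ e - 1 →
      DefinedOver ι B → 0 < R → (∀ i, 0 < δ i) → (∀ i, δ i ≤ 1) → Monotone δ →
      C ≤ height ι B * R ^ e * ∏ i, δ i ^ q →
      ∃ B' : Submodule 𝕜 (EuclideanSpace 𝕜 (Fin n)), B' ≤ B ∧ Module.finrank 𝕜 B' = e - 1 ∧
        DefinedOver ι B' ∧ height ι B' ≤ C * height ι B * R ∧
        ∀ i : Fin h, height ι B' * omega (i + 1) A B' ^ q ≤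
          C * height ι B * R * (omega (i + 1) A B ^ q + δ i ^ q) := by
  choose C hC1 hC using fun k => exists_going_down_step_of_dim ι q hcase k n
  have hC0 : ∀ k, 0 ≤ C k := fun k => zero_le_one.trans (hC1 k)
  -- The dimension of B is k + 2 ≤ n, so summing the finitely many constants removes the dependence
  -- on it.
  refine ⟨∑ k ∈ Finset.range (n + 1), C k, ?_, fun h e A B R δ hh hBrank hA he hB hR hδ hδ1 hmono
    hcond => ?_⟩
  · exact (hC1 0).trans (Finset.single_le_sum (fun k _ => hC0 k) (by simp))
  · obtain ⟨k, rfl⟩ : ∃ k, e = k + 1 + 1 := ⟨e - 2, by omega⟩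
    have hBn : k + 1 + 1 ≤ n := by
      have := B.finrank_le
      rw [hBrank] at this
      simpa using this
    have hle : C k ≤ ∑ k ∈ Finset.range (n + 1), C k :=
      Finset.single_le_sum (fun k _ => hC0 k) (by simp; omega)
    obtain ⟨B', h1, h2, h3, h4, h5⟩ := hC k h A B R δ hBrank hA (by omega) hB hR hδ hδ1 hmono
      (hle.trans hcond)
    have hBpos : 0 < height ι B := subspaceHeight_pos _
    refine ⟨B', h1, by simpa using h2, h3, h4.trans (by gcongr), fun i => (h5 i).trans ?_⟩
    have := omega_nonneg (i + 1) A B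
    have := (hδ i).le
    gcongr

end Step

end GoingDown
end

noncomputable section
namespace GoingDown

/-! ### The choice of the parameters -/

/-- Since a^(-(q y - 1)) = a (a^(-y))^q, cancelling a and taking q-th roots turns a bound on H(B')
ω^q into one on ω. -/
theorem le_of_mul_pow_le {q : ℕ} (hq : q ≠ 0) {a w C c y : ℝ} (ha : 0 < a) (hC : 1 ≤ C)
    (hc : 0 ≤ c) (h : a * w ^ q ≤ C * c ^ q * a ^ (-(q * y - 1))) : w ≤ C * c * a ^ (-y) := by
  refine le_of_pow_le_pow_left₀ hq (by positivity) ?_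
  have h1 : a ^ (-(q * y - 1)) = a * (a ^ (-y)) ^ q := by
    rw [← Real.rpow_mul_natCast ha.le, neg_sub, sub_eq_add_neg, Real.rpow_add ha, Real.rpow_one]
    congr 2
    ring
  rw [h1] at h
  have h2 : w ^ q ≤ C * c ^ q * (a ^ (-y)) ^ q := by
    refine le_of_mul_le_mul_left ?_ ha
    linarith
  calc w ^ q ≤ C * c ^ q * (a ^ (-y)) ^ q := h2
    _ ≤ C ^ q * c ^ q * (a ^ (-y)) ^ q := by
      gcongr
      exact le_self_pow₀ hC hq
    _ = (C * c * a ^ (-y)) ^ q := by rw [mul_pow, mul_pow]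

theorem one_le_height {𝕜 : Type*} [RCLike 𝕜] {K : Type*} [Field K] [NumberField K] (ι : K →+* 𝕜)
    {n : ℕ} (B : Submodule 𝕜 (EuclideanSpace 𝕜 (Fin n))) : 1 ≤ height ι B :=
  one_le_subspaceHeight _

/-- The parameters of the first part fulfil the condition of the going-down step. -/
theorem le_mul_prod_of_exponents {h e q : ℕ} (hh : 1 ≤ h) (he : 1 ≤ e) {C H b Y : ℝ}
    {y : Fin h → ℝ} (hC : 1 ≤ C) (hb : 1 ≤ b) (hbH : b ≤ H) (hY : Y = ∑ i, y i) :
    C ≤ b * (C * H ^ ((q * Y - 1) / e)) ^ e * ∏ i, H ^ (1 - q * y i) / b := by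
  have hH : 0 < H := by linarith
  have hb0 : 0 < b := by linarith
  have he0 : (e : ℝ) ≠ 0 := by positivity
  have h1 : ∏ i, H ^ (1 - q * y i) / b = H ^ (h - q * Y) / b ^ h := by
    rw [Finset.prod_div_distrib, ← Real.rpow_sum_of_pos hH]
    simp [hY, Finset.mul_sum]
  have h2 : (C * H ^ ((q * Y - 1) / e)) ^ e = C ^ e * H ^ (q * Y - 1) := by
    rw [mul_pow, ← Real.rpow_mul_natCast hH.le, div_mul_cancel₀ _ he0]
  obtain ⟨m, rfl⟩ : ∃ m, h = m + 1 := ⟨h - 1, by omega⟩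
  have h3 : H ^ (q * Y - 1) * H ^ (((m + 1 : ℕ) : ℝ) - q * Y) = H ^ m := by
    rw [← Real.rpow_add hH, ← Real.rpow_natCast]
    congr 1
    push_cast
    ring
  -- The powers of H combine to exponent h - 1 and those of b to -(h - 1), leaving (H/b)^(h - 1) ≥
  -- 1.
  have h4 : b * (C ^ e * H ^ (q * Y - 1)) * (H ^ (((m + 1 : ℕ) : ℝ) - q * Y) / b ^ (m + 1)) =
      C ^ e * (H / b) ^ m := by
    rw [div_pow, ← h3, pow_succ]
    field_simp
  rw [h1, h2, h4]
  have h5 : 1 ≤ (H / b) ^ m := one_le_pow₀ ((one_le_div hb0).2 hbH)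
  calc C ≤ C ^ e := le_self_pow₀ hC (by omega)
    _ ≤ C ^ e * (H / b) ^ m := le_mul_of_one_le_right (by positivity) h5

/-- The estimate of the second part for the value of the parameter `δ ^ q`. -/
theorem mul_rpow_le_of_exponents {h e n : ℕ} (hh : 1 ≤ h) (hhe : h ≤ e) (hen : e ≤ n)
    {C H H' b : ℝ} (hC : 1 ≤ C) (hb : 1 ≤ b) (hbH : b ≤ H) (hH' : 0 < H') :
    C * b * (H' / (C * H)) * (C / (b * (H' / (C * H)) ^ e)) ^ ((h : ℝ)⁻¹) ≤
      C ^ (n + 2) * H ^ ((e : ℝ) / h) * H' ^ (-((e : ℝ) / h - 1)) := by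
  have hH : 0 < H := by linarith
  have hb0 : 0 < b := by linarith
  have hC0 : 0 < C := by linarith
  have hh0 : (1 : ℝ) ≤ h := by exact_mod_cast hh
  have hh0' : (0 : ℝ) < h := by linarith
  have hhe' : (h : ℝ) ≤ e := by exact_mod_cast hhe
  have hen' : (e : ℝ) ≤ n := by exact_mod_cast hen
  set u : ℝ := (h : ℝ)⁻¹ with hu
  have hu1 : u ≤ 1 := inv_le_one_of_one_le₀ hh0
  have hu0 : 0 < u := by positivity
  have heu : (e : ℝ) / h = e * u := rfl
  have heu1 : 1 ≤ e * u := by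
    rw [← heu, one_le_div hh0']
    exact hhe'
  have heun : e * u ≤ n := (mul_le_of_le_one_right (by positivity) hu1).trans hen'
  set R := H' / (C * H) with hR
  have hR0 : 0 < R := by positivity
  have h1 : (C / (b * R ^ e)) ^ u = C ^ u * b ^ (-u) * R ^ (-(e * u)) := by
    rw [Real.div_rpow hC0.le (by positivity), Real.mul_rpow hb0.le (by positivity),
      ← Real.rpow_natCast_mul hR0.le, Real.rpow_neg hb0.le, Real.rpow_neg hR0.le]
    field_simp
  have h2 : R ^ (1 - e * u) = H' ^ (-(e * u - 1)) * (C ^ (e * u - 1) * H ^ (e * u - 1)) := by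
    rw [hR, Real.div_rpow hH'.le (by positivity), Real.mul_rpow hC0.le hH.le, neg_sub,
      show 1 - e * u = -(e * u - 1) by ring, Real.rpow_neg hC0.le, Real.rpow_neg hH.le]
    field_simp
  have h3 : b * b ^ (-u) = b ^ (1 - u) := by
    rw [sub_eq_add_neg, Real.rpow_add hb0, Real.rpow_one]
  have h4 : R * R ^ (-(e * u)) = R ^ (1 - e * u) := by
    rw [sub_eq_add_neg, Real.rpow_add hR0, Real.rpow_one]
  have h5 : b ^ (1 - u) ≤ H := by
    calc b ^ (1 - u) ≤ b ^ (1 : ℝ) := Real.rpow_le_rpow_of_exponent_le hb (by linarith)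
      _ = b := Real.rpow_one b
      _ ≤ H := hbH
  have h6 : C * C ^ u * C ^ (e * u - 1) ≤ C ^ (n + 2) := by
    have h7 : C * C ^ u * C ^ (e * u - 1) = C ^ (u + e * u) := by
      rw [show u + e * u = 1 + u + (e * u - 1) by ring, Real.rpow_add hC0, Real.rpow_add hC0,
        Real.rpow_one]
    rw [h7, ← Real.rpow_natCast]
    refine Real.rpow_le_rpow_of_exponent_le hC ?_
    push_cast
    linarith
  have h8 : H * H ^ (e * u - 1) = H ^ (e * u) := by
    rw [Real.rpow_sub hH, Real.rpow_one]
    field_simp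
  rw [h1, heu]
  calc C * b * R * (C ^ u * b ^ (-u) * R ^ (-(e * u)))
      = C * C ^ u * (b * b ^ (-u)) * (R * R ^ (-(e * u))) := by ring
    _ = (C * C ^ u * C ^ (e * u - 1)) * (b ^ (1 - u) * H ^ (e * u - 1)) *
          H' ^ (-(e * u - 1)) := by
        rw [h3, h4, h2]
        ring
    _ ≤ C ^ (n + 2) * (H * H ^ (e * u - 1)) * H' ^ (-(e * u - 1)) := by gcongr
    _ = _ := by rw [h8]

end GoingDown
end

/-- Going-down theorem. The cases of `hcase` are the real case (Euclidean space, `q = 1`) and the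
complex case (unitary space, `q = 2`, the embedding of `K` is not real). -/
theorem theorem1p1 {𝕜 : Type*} [RCLike 𝕜] {K : Type*} [Field K] [NumberField K] (ι : K →+* 𝕜)
    (q : ℕ)
    (hcase : (Module.finrank ℝ 𝕜 = 1 ∧ q = 1) ∨
      (Module.finrank ℝ 𝕜 = 2 ∧ q = 2 ∧ ∃ x : K, star (ι x) ≠ ι x))
    (n : ℕ) :
    (∀ (h : ℕ) (y : Fin h → ℝ), 1 ≤ h → Antitone y → (∀ i, ((q : ℝ) * h)⁻¹ ≤ y i) →
      ∃ C₅ C₆ C₇ C₈ : ℝ, 0 < C₅ ∧ 0 < C₆ ∧ 0 < C₇ ∧ 0 < C₈ ∧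
        ∀ (d e : ℕ) (A B : Submodule 𝕜 (EuclideanSpace 𝕜 (Fin n))) (H c Y : ℝ) (y' : Fin h → ℝ)
          (H' : ℝ),
          Module.finrank 𝕜 A = d → Module.finrank 𝕜 B = e → h ≤ min d (e - 1) →
          GoingDown.DefinedOver ι B → 1 ≤ H → GoingDown.height ι B ≤ H → 1 ≤ c →
          (∀ i : Fin h, GoingDown.height ι B * GoingDown.omega (i + 1) A B ^ q ≤
            c ^ q * H ^ (-(q * y i - 1))) →
          Y = ∑ i, y i →
          (∀ i, y' i = y i * e * (q * Y + e - 1)⁻¹) →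
          (∀ i, (q : ℝ)⁻¹ ≤ y' i) →
          H' = C₅ * H ^ ((e + q * Y - 1) / e) →
          ∃ B' : Submodule 𝕜 (EuclideanSpace 𝕜 (Fin n)),
            B' ≤ B ∧ Module.finrank 𝕜 B' = e - 1 ∧ GoingDown.DefinedOver ι B' ∧
            GoingDown.height ι B' ≤ C₅ * GoingDown.height ι B * H ^ ((q * Y - 1) / e) ∧
            C₅ * GoingDown.height ι B * H ^ ((q * Y - 1) / e) ≤ H' ∧
            (∀ i : Fin h, GoingDown.height ι B' * GoingDown.omega (i + 1) A B' ^ q ≤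
              C₆ * c ^ q * H ^ (-(q * y' i - 1) * (q * Y + e - 1) / e)) ∧
            (∀ i : Fin h, C₆ * c ^ q * H ^ (-(q * y' i - 1) * (q * Y + e - 1) / e) ≤
              C₇ * c ^ q * H' ^ (-(q * y' i - 1))) ∧
            (∀ i : Fin h, GoingDown.omega (i + 1) A B' ≤
              C₈ * c * GoingDown.height ι B' ^ (-y' i))) ∧
    (∃ C₉ C₁₀ C₁₁ : ℝ, 0 < C₉ ∧ 0 < C₁₀ ∧ 0 < C₁₁ ∧
      ∀ (h d e : ℕ) (A B : Submodule 𝕜 (EuclideanSpace 𝕜 (Fin n))) (H y₀' : ℝ),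
        Module.finrank 𝕜 A = d → Module.finrank 𝕜 B = e → 1 ≤ h → h ≤ min d (e - 1) →
        GoingDown.DefinedOver ι B → 1 ≤ H → GoingDown.height ι B ≤ H →
        (∀ i : Fin h, GoingDown.omega (i + 1) A B = 0) →
        y₀' = e * ((q : ℝ) * h)⁻¹ →
        ∀ H' : ℝ, C₉ * H ≤ H' →
          ∃ B' : Submodule 𝕜 (EuclideanSpace 𝕜 (Fin n)),
            B' ≤ B ∧ Module.finrank 𝕜 B' = e - 1 ∧ GoingDown.DefinedOver ι B' ∧
            GoingDown.height ι B' ≤ H' ∧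
            (∀ i : Fin h, GoingDown.height ι B' * GoingDown.omega (i + 1) A B' ^ q ≤
              C₁₀ * H ^ (q * y₀') * H' ^ (-(q * y₀' - 1))) ∧
            (∀ i : Fin h, GoingDown.omega (i + 1) A B' ≤
              C₁₁ * H ^ y₀' * GoingDown.height ι B' ^ (-y₀'))) := by
  have hq : q ≠ 0 := by
    rcases hcase with ⟨-, rfl⟩ | ⟨-, rfl, -⟩ <;> norm_num
  have hq0 : (0 : ℝ) < q := by exact_mod_cast Nat.pos_of_ne_zero hq
  obtain ⟨C, hC1, hstep⟩ := GoingDown.exists_going_down_step ι q hcase n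
  have hC0 : 0 < C := by linarith
  refine ⟨fun h y hh hy hylow => ?_, ?_⟩
  · have hh0 : (0 : ℝ) < h := by exact_mod_cast hh
    have hy0 : ∀ i, 0 ≤ y i := fun i => le_trans (by positivity) (hylow i)
    have hC7 : 1 ≤ 2 * C ^ 2 * (C ^ 2) ^ (q * ∑ i, y i) := by
      have h1 : (1 : ℝ) ≤ C ^ 2 := one_le_pow₀ hC1
      have h2 : (1 : ℝ) ≤ (C ^ 2) ^ (q * ∑ i, y i) :=
        Real.one_le_rpow h1 (mul_nonneg hq0.le (Finset.sum_nonneg fun i _ => hy0 i))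
      nlinarith
    -- One factor C comes from the step, the other from R = C H^((qY - 1)/e), and 2 from adding two
    -- equal terms. The power of C² compensates for C₅ when H is replaced by H'.
    refine ⟨C ^ 2, 2 * C ^ 2, 2 * C ^ 2 * (C ^ 2) ^ (q * ∑ i, y i),
      2 * C ^ 2 * (C ^ 2) ^ (q * ∑ i, y i), by positivity, by positivity, by positivity,
      by positivity, ?_⟩
    rintro d e A B H c Y y' H' rfl hB hhde hdef hH hBH hc hω hY hy' hy'low hH'
    have hhA : h ≤ Module.finrank 𝕜 A := hhde.trans (min_le_left _ _)
    have hhe : h ≤ e - 1 := hhde.trans (min_le_right _ _)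
    have he2 : 2 ≤ e := by omega
    have he2' : (2 : ℝ) ≤ e := by exact_mod_cast he2
    have hH0 : 0 < H := by linarith
    have hb1 := GoingDown.one_le_height ι B
    set b := GoingDown.height ι B with hb
    have hb0 : 0 < b := by linarith
    have hqY : 1 ≤ q * Y := by
      have h1 : ∑ _i : Fin h, ((q : ℝ) * h)⁻¹ ≤ ∑ i, y i := Finset.sum_le_sum fun i _ => hylow i
      rw [Finset.sum_const, Finset.card_univ, Fintype.card_fin, nsmul_eq_mul, ← hY] at h1
      have h2 : (h : ℝ) * ((q : ℝ) * h)⁻¹ = (q : ℝ)⁻¹ := by field_simp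
      rw [h2, inv_le_iff_one_le_mul₀' hq0] at h1
      exact h1
    have hs0 : 0 < q * Y + e - 1 := by linarith
    have hy'le : ∀ i, y' i ≤ y i := by
      intro i
      rw [hy' i, mul_assoc]
      refine mul_le_of_le_one_right (hy0 i) ?_
      rw [← div_eq_mul_inv, div_le_one hs0]
      linarith
    have hqy' : ∀ i, 1 ≤ q * y' i := fun i => by
      have := hy'low i
      rwa [inv_le_iff_one_le_mul₀' hq0] at this
    -- Obtained from the assumption y'_i ≥ 1/q and y'_i ≤ y_i; it is what makes δ_i ≤ 1 below.
    have hqy : ∀ i, 1 ≤ q * y i := fun i =>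
      (hqy' i).trans (mul_le_mul_of_nonneg_left (hy'le i) hq0.le)
    have hg0 : ∀ i, 0 < H ^ (1 - q * y i) / b := fun i => by positivity
    have hδq : ∀ i, ((H ^ (1 - q * y i) / b) ^ ((q : ℝ)⁻¹)) ^ q = H ^ (1 - q * y i) / b :=
      fun i => Real.rpow_inv_natCast_pow (hg0 i).le hq
    -- Choosing δ_i^q = H^(1 - q y_i) / H(B) makes the new error comparable with the assumed bound
    -- for ω_i^q, and R is the value for which Minkowski's condition then holds.
    obtain ⟨B', hB'B, hrank, hdef', hht, hom⟩ := hstep h e A B (C * H ^ ((q * Y - 1) / e))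
      (fun i => (H ^ (1 - q * y i) / b) ^ ((q : ℝ)⁻¹)) hh hB hhA hhe hdef (by positivity)
      (fun i => Real.rpow_pos_of_pos (hg0 i) _)
      (fun i => by
        refine Real.rpow_le_one (hg0 i).le ?_ (by positivity)
        rw [div_le_one hb0]
        exact (Real.rpow_le_one_of_one_le_of_nonpos hH (by linarith [hqy i])).trans hb1)
      (fun i j hij => by
        have := hy hij
        have h1 : H ^ (1 - q * y i) ≤ H ^ (1 - q * y j) := by
          refine Real.rpow_le_rpow_of_exponent_le hH ?_
          have := mul_le_mul_of_nonneg_left this hq0.le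
          linarith
        have := (hg0 i).le
        simp only
        gcongr)
      (by
        simp only [hδq]
        exact GoingDown.le_mul_prod_of_exponents hh (by omega) hC1 hb1 hBH hY)
    simp only [hδq] at hom
    set b' := GoingDown.height ι B' with hb'
    have hb'0 : 0 < b' := one_pos.trans_le (GoingDown.one_le_height ι B')
    have hht' : b' ≤ C ^ 2 * b * H ^ ((q * Y - 1) / e) := hht.trans_eq (by rw [← hb]; ring)
    have hHH' : C ^ 2 * b * H ^ ((q * Y - 1) / e) ≤ H' := by
      have h1 : H ^ (((e : ℝ) + q * Y - 1) / e) = H * H ^ ((q * Y - 1) / e) := by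
        rw [show ((e : ℝ) + q * Y - 1) / e = 1 + (q * Y - 1) / e by field_simp; ring,
          Real.rpow_add hH0, Real.rpow_one]
      rw [hH', h1, mul_assoc]
      gcongr
    have hH'0 : 0 < H' := by
      rw [hH']
      positivity
    -- The definition of y' is designed for this identity: the left side is the exponent of R plus
    -- that of δ_i^q.
    have hexp : ∀ i, -(q * y' i - 1) * (q * Y + e - 1) / e =
        (q * Y - 1) / e + (1 - q * y i) := by
      intro i
      rw [hy' i]
      field_simp
      ring
    have h6 : ∀ i : Fin h, b' * GoingDown.omega (i + 1) A B' ^ q ≤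
        2 * C ^ 2 * c ^ q * H ^ (-(q * y' i - 1) * (q * Y + e - 1) / e) := by
      intro i
      have h1 := hω i
      rw [neg_sub] at h1
      have hcq : 1 ≤ c ^ q := one_le_pow₀ hc
      rw [hexp, Real.rpow_add hH0]
      calc _ ≤ _ := hom i
        _ = C ^ 2 * H ^ ((q * Y - 1) / e) *
              (b * GoingDown.omega (i + 1) A B ^ q + H ^ (1 - q * y i)) := by
            rw [← hb]
            field_simp
        _ ≤ C ^ 2 * H ^ ((q * Y - 1) / e) *
              (c ^ q * H ^ (1 - q * y i) + c ^ q * H ^ (1 - q * y i)) := by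
            gcongr
            exact le_mul_of_one_le_left (by positivity) hcq
        _ = _ := by ring
    have h7 : ∀ i : Fin h, 2 * C ^ 2 * c ^ q * H ^ (-(q * y' i - 1) * (q * Y + e - 1) / e) ≤
        2 * C ^ 2 * (C ^ 2) ^ (q * ∑ i, y i) * c ^ q * H' ^ (-(q * y' i - 1)) := by
      intro i
      have h1 : H' ^ (-(q * y' i - 1)) = (C ^ 2) ^ (-(q * y' i - 1)) *
          H ^ (-(q * y' i - 1) * (q * Y + e - 1) / e) := by
        rw [hH', Real.mul_rpow (by positivity) (by positivity), ← Real.rpow_mul hH0.le]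
        congr 2
        ring
      have h2 : 1 ≤ (C ^ 2) ^ (q * ∑ i, y i) * (C ^ 2) ^ (-(q * y' i - 1)) := by
        rw [← Real.rpow_add (by positivity)]
        refine Real.one_le_rpow (one_le_pow₀ hC1) ?_
        have h3 : y i ≤ ∑ i, y i := Finset.single_le_sum (fun i _ => hy0 i) (Finset.mem_univ i)
        have h4 := mul_le_mul_of_nonneg_left ((hy'le i).trans h3) hq0.le
        linarith
      rw [h1]
      calc _ = 2 * C ^ 2 * c ^ q * H ^ (-(q * y' i - 1) * (q * Y + e - 1) / e) * 1 := by ring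
        _ ≤ 2 * C ^ 2 * c ^ q * H ^ (-(q * y' i - 1) * (q * Y + e - 1) / e) *
              ((C ^ 2) ^ (q * ∑ i, y i) * (C ^ 2) ^ (-(q * y' i - 1))) := by gcongr
        _ = _ := by ring
    refine ⟨B', hB'B, hrank, hdef', hht', hHH', h6, h7, fun i => ?_⟩
    refine GoingDown.le_of_mul_pow_le hq hb'0 hC7 (by linarith)
      (((h6 i).trans (h7 i)).trans ?_)
    have h8 : H' ^ (-(q * y' i - 1)) ≤ b' ^ (-(q * y' i - 1)) :=
      Real.rpow_le_rpow_of_nonpos hb'0 (hht'.trans hHH') (by linarith [hqy' i])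
    gcongr
  · refine ⟨C ^ 2, C ^ (n + 2), C ^ (n + 2), by positivity, by positivity, by positivity, ?_⟩
    rintro h d e A B H y₀' rfl hB hh hhde hdef hH hBH hω hy₀' H' hH'
    have hhA : h ≤ Module.finrank 𝕜 A := hhde.trans (min_le_left _ _)
    have hhe : h ≤ e - 1 := hhde.trans (min_le_right _ _)
    have hen : e ≤ n := by
      have := B.finrank_le
      rw [hB] at this
      simpa using this
    have hh0 : (0 : ℝ) < h := by exact_mod_cast hh
    have hH0 : 0 < H := by linarith
    have hH'0 : 0 < H' := lt_of_lt_of_le (by positivity) hH'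
    have hb1 := GoingDown.one_le_height ι B
    set b := GoingDown.height ι B with hb
    have hb0 : 0 < b := by linarith
    have hqy : q * y₀' = (e : ℝ) / h := by
      rw [hy₀']
      field_simp
    -- The largest R for which the step guarantees height at most H' given only H(B) ≤ H. The choice
    -- C₉ = C² yields R ≥ C, hence g ≤ 1.
    set R := H' / (C * H) with hR
    have hR0 : 0 < R := by positivity
    have hRC : C ≤ R := by
      rw [hR, le_div_iff₀ (by positivity)]
      linarith
    have hRe : C ≤ b * R ^ e := by
      have h1 : R ≤ R ^ e := le_self_pow₀ (hC1.trans hRC) (by omega)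
      exact (hRC.trans h1).trans (le_mul_of_one_le_left (by positivity) hb1)
    set g := C / (b * R ^ e) with hg
    have hg0 : 0 < g := by positivity
    have hg1 : g ≤ 1 := (div_le_one (by positivity)).2 hRe
    -- All ω_i(A, B) vanish, so the δ_i are taken equal with δ^q = z, giving equality in Minkowski's
    -- condition.
    set z := g ^ ((h : ℝ)⁻¹) with hz
    have hz0 : 0 < z := Real.rpow_pos_of_pos hg0 _
    have hz1 : z ≤ 1 := Real.rpow_le_one hg0.le hg1 (by positivity)
    have hzh : z ^ h = g := Real.rpow_inv_natCast_pow hg0.le (by omega)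
    have hzq : (z ^ ((q : ℝ)⁻¹)) ^ q = z := Real.rpow_inv_natCast_pow hz0.le hq
    obtain ⟨B', hB'B, hrank, hdef', hht, hom⟩ := hstep h e A B R (fun _ => z ^ ((q : ℝ)⁻¹))
      hh hB hhA hhe hdef hR0 (fun _ => Real.rpow_pos_of_pos hz0 _)
      (fun _ => Real.rpow_le_one hz0.le hz1 (by positivity)) (fun _ _ _ => le_rfl)
      (by
        simp only [hzq, Finset.prod_const, Finset.card_univ, Fintype.card_fin, hzh]
        rw [hg, ← hb, mul_div_cancel₀ _ (by positivity)])
    simp only [hzq] at hom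
    set b' := GoingDown.height ι B' with hb'
    have hb'0 : 0 < b' := one_pos.trans_le (GoingDown.one_le_height ι B')
    have hb'H' : b' ≤ H' := by
      refine hht.trans ?_
      rw [← hb]
      calc C * b * R ≤ C * H * R := by gcongr
        _ = H' := mul_div_cancel₀ _ (by positivity)
    have h10 : ∀ i : Fin h, b' * GoingDown.omega (i + 1) A B' ^ q ≤
        C ^ (n + 2) * H ^ (q * y₀') * H' ^ (-(q * y₀' - 1)) := by
      intro i
      refine (hom i).trans ?_
      rw [hω i, zero_pow hq, zero_add, hqy]
      exact GoingDown.mul_rpow_le_of_exponents hh (by omega) hen hC1 hb1 hBH hH'0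
    refine ⟨B', hB'B, hrank, hdef', hb'H', h10, fun i => ?_⟩
    -- Here H^y₀' plays the role of c, because H^(q y₀') is its q-th power.
    refine GoingDown.le_of_mul_pow_le hq hb'0 (one_le_pow₀ hC1) (by positivity)
      ((h10 i).trans ?_)
    have h8 : H' ^ (-(q * y₀' - 1)) ≤ b' ^ (-(q * y₀' - 1)) := by
      refine Real.rpow_le_rpow_of_nonpos hb'0 hb'H' ?_
      rw [hqy, neg_sub, sub_nonpos, one_le_div hh0]
      exact_mod_cast (by omega : h ≤ e)
    rw [← Real.rpow_mul_natCast hH0.le, mul_comm y₀']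
    gcongr
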